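/- Let $A$ be a finitely generated group that splits as a free product $A = F_n * A_1 * \cdots * A_k$ of subgroups, where $n \ge 2$, $k \ge 0$ and $F_n$ is free with basis $\{x_1,\dots,x_n\}$, and put $\mathcal{A} = \{A_1,\dots,A_k\}$. Let $O = \mathrm{Out}(A;\mathcal{A}^t)$ be the group of all outer automorphisms $\Phi$ of $A$ that act trivially on each $A_j$, i.e. for each $j$ there is a representative $\varphi \in \Phi$ restricting to the identity on $A_j$. For a subgroup $H \le A$ let $\mathrm{Stab}_O(H)$ be the subgroup of those $\Phi \in O$ that have a representative $\varphi$ with $\varphi(H) = H$. A free factor of $A$ is a subgroup $B \le A$ such that $A = B * C$ for some subgroup $C \le A$. For subgroups of $A$, write $[B_1] \le [B_2]$ if $B_1$ is contained in a conjugate of $B_2$; here $[B]$ is the conjugacy class of $B$. Let $\mathcal{F}(A;\mathcal{A})$ be the poset of all conjugacy classes $[B]$ of proper free factors $B \subsetneq A$ for which there is a free factor $B'$ of $A$ with $[A_j] \le [B']$ for all $j$ and $B' \subsetneq B$. The free factor complex of $A$ relative to $\mathcal{A}$ is the order complex of $\mathcal{F}(A;\mathcal{A})$: its vertices are the elements of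 the poset and its simplices are the finite non-empty chains. The group $O$ acts on it by $[\varphi]\cdot[B] = [\varphi(B)]$. For $1 \le i \le n-1$ let $S_i = \langle x_1,\dots,x_i\rangle * A_1 * \cdots * A_k \le A$ and $P_i = \mathrm{Stab}_O(S_i)$, and let $\mathcal{P} = \{P_i \mid 1 \le i \le n-1\}$. The coset complex $\mathrm{CC}(O,\mathcal{P})$ is the simplicial complex whose vertices are the left cosets $\Phi P$ with $\Phi \in O$ and $P \in \mathcal{P}$, where finitely many (at least one) vertices form a simplex if and only if their intersection is non-empty; $O$ acts on it by left multiplication. Proposition. The free factor complex of $A$ relative to $\mathcal{A}$ is $O$-equivariantly isomorphic, as a simplicial complex, to the coset complex $\mathrm{CC}(O,\mathcal{P})$. -/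

import Mathlib

open scoped Pointwise

namespace RelFF

/-! ### Abstract simplicial complexes -/

section Complexes

/-- The order complex of a poset: its simplices are the finite non-empty chains. -/
def orderComplex (P : Type*) [PartialOrder P] : AbstractSimplicialComplex P where
  faces := {s | s.Nonempty ∧ IsChain (· ≤ ·) (s : Set P)}
  isRelLowerSet_faces := fun _ hs =>
    ⟨hs.1, fun _ hts ht => ⟨ht, hs.2.mono (Finset.coe_subset.2 hts)⟩⟩
  singleton_mem v := ⟨Finset.singleton_nonempty v, by simp⟩

/-- The nerve of a collection `𝒰` of non-empty subsets of `X`: the vertices are the members of `𝒰`,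
and finitely many of them form a simplex iff their intersection is non-empty. -/
def nerve {X : Type*} (𝒰 : Set (Set X)) (h𝒰 : ∀ U ∈ 𝒰, U.Nonempty) :
    AbstractSimplicialComplex 𝒰 where
  faces := {s | s.Nonempty ∧ (⋂ U ∈ s, (U : Set X)).Nonempty}
  isRelLowerSet_faces := fun _ hs =>
    ⟨hs.1, fun _ hts ht => ⟨ht, hs.2.mono (Set.biInter_subset_biInter_left hts)⟩⟩
  singleton_mem v := ⟨Finset.singleton_nonempty v, by simpa using h𝒰 v v.2⟩

/-- `G`-equivariant isomorphism of simplicial complexes with a `G`-action on the vertices: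
an equivariant bijection between the vertices under which simplices correspond to simplices. -/
def EquivariantlyIsomorphic (G : Type*) [Group G] {V W : Type*} [MulAction G V] [MulAction G W]
    (K : AbstractSimplicialComplex V) (L : AbstractSimplicialComplex W) : Prop :=
  ∃ e : V ≃ W, (∀ s : Finset V, s.map e.toEmbedding ∈ L.faces ↔ s ∈ K.faces) ∧
    ∀ (g : G) (v : V), e (g • v) = g • e v

end Complexes

/-! ### Coset complexes -/

section CosetComplex

variable {G : Type*} [Group G]

/-- The collection of all left cosets `gH` with `g ∈ G` and `H ∈ ℋ`. -/
def cosets (ℋ : Set (Subgroup G)) : Set (Set G) :=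
  {U | ∃ H ∈ ℋ, ∃ g : G, U = g • (H : Set G)}

theorem cosets_nonempty (ℋ : Set (Subgroup G)) : ∀ U ∈ cosets ℋ, U.Nonempty := by
  rintro _ ⟨H, -, g, rfl⟩
  exact ⟨g • 1, Set.smul_mem_smul_set H.one_mem⟩

/-- `G` acts on the cosets by left multiplication. -/
instance cosetsAction (ℋ : Set (Subgroup G)) : MulAction G (cosets ℋ) where
  smul g U := ⟨g • (U : Set G), by
    obtain ⟨H, hH, g', hU⟩ := U.2
    exact ⟨H, hH, g * g', by rw [hU, smul_smul]⟩⟩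
  one_smul U := Subtype.ext (one_smul G (U : Set G))
  mul_smul g g' U := Subtype.ext (mul_smul g g' (U : Set G))

/-- The coset complex of `G` with respect to the family `ℋ`. -/
def cosetComplex (ℋ : Set (Subgroup G)) : AbstractSimplicialComplex (cosets ℋ) :=
  nerve (cosets ℋ) (cosets_nonempty ℋ)

end CosetComplex

/-! ### Outer automorphisms and relative outer automorphism groups -/

section Outer

variable {A : Type*} [Group A]

/-- For an automorphism `φ`, one has `φ ∘ conj_g ∘ φ⁻¹ = conj_{φ(g)}`. -/
theorem mul_conj_mul_inv (φ : MulAut A) (g : A) :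
    φ * MulAut.conj g * φ⁻¹ = MulAut.conj (φ g) := by
  ext a
  simp [MulAut.mul_apply, MulAut.conj_apply]

instance innerNormal : ((MulAut.conj : A →* MulAut A).range).Normal where
  conj_mem := by
    rintro _ ⟨g, rfl⟩ φ
    exact ⟨φ g, (mul_conj_mul_inv φ g).symm⟩

variable (A) in
/-- The outer automorphism group `Out(A) = Aut(A) / Inn(A)`. -/
abbrev Out : Type _ := MulAut A ⧸ (MulAut.conj : A →* MulAut A).range

/-- The class `[φ] ∈ Out(A)` of an automorphism `φ`. -/
abbrev toOut (φ : MulAut A) : Out A := QuotientGroup.mk φ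

/-- `Φ` stabilises `H`: some representative `φ` of `Φ` satisfies `φ(H) = H`. -/
def Stabilises (Φ : Out A) (H : Subgroup A) : Prop :=
  ∃ φ : MulAut A, toOut φ = Φ ∧ φ • H = H

/-- `Φ` acts trivially on `H`: some representative of `Φ` restricts to the identity on `H`. -/
def ActsTrivially (Φ : Out A) (H : Subgroup A) : Prop :=
  ∃ φ : MulAut A, toOut φ = Φ ∧ ∀ h ∈ H, φ h = h

theorem Stabilises.one (H : Subgroup A) : Stabilises 1 H := ⟨1, rfl, one_smul _ _⟩

theorem Stabilises.mul {Φ Ψ : Out A} {H : Subgroup A} (h₁ : Stabilises Φ H)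
    (h₂ : Stabilises Ψ H) : Stabilises (Φ * Ψ) H := by
  obtain ⟨φ, rfl, hφ⟩ := h₁
  obtain ⟨ψ, rfl, hψ⟩ := h₂
  exact ⟨φ * ψ, rfl, by rw [mul_smul, hψ, hφ]⟩

theorem Stabilises.inv {Φ : Out A} {H : Subgroup A} (h : Stabilises Φ H) :
    Stabilises Φ⁻¹ H := by
  obtain ⟨φ, rfl, hφ⟩ := h
  exact ⟨φ⁻¹, rfl, inv_smul_eq_iff.2 hφ.symm⟩

theorem ActsTrivially.one (H : Subgroup A) : ActsTrivially 1 H := ⟨1, rfl, fun _ _ => rfl⟩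

theorem ActsTrivially.mul {Φ Ψ : Out A} {H : Subgroup A} (h₁ : ActsTrivially Φ H)
    (h₂ : ActsTrivially Ψ H) : ActsTrivially (Φ * Ψ) H := by
  obtain ⟨φ, rfl, hφ⟩ := h₁
  obtain ⟨ψ, rfl, hψ⟩ := h₂
  exact ⟨φ * ψ, rfl, fun h hh => by rw [MulAut.mul_apply, hψ h hh, hφ h hh]⟩

theorem ActsTrivially.inv {Φ : Out A} {H : Subgroup A} (h : ActsTrivially Φ H) :
    ActsTrivially Φ⁻¹ H := by
  obtain ⟨φ, rfl, hφ⟩ := h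
  refine ⟨φ⁻¹, rfl, fun h hh => ?_⟩
  conv_lhs => rw [← hφ h hh]
  exact MulAut.inv_apply_self A φ h

/-- The relative outer automorphism group `Out(A; 𝒢, ℋᵗ)`: the outer automorphisms that stabilise
each member of `𝒢` and act trivially on each member of `ℋ`. -/
def relOut (𝒢 ℋ : Set (Subgroup A)) : Subgroup (Out A) where
  carrier := {Φ | (∀ H ∈ 𝒢, Stabilises Φ H) ∧ ∀ H ∈ ℋ, ActsTrivially Φ H}
  mul_mem' h₁ h₂ := ⟨fun H hH => (h₁.1 H hH).mul (h₂.1 H hH),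
    fun H hH => (h₁.2 H hH).mul (h₂.2 H hH)⟩
  one_mem' := ⟨fun H _ => .one H, fun H _ => .one H⟩
  inv_mem' h := ⟨fun H hH => (h.1 H hH).inv, fun H hH => (h.2 H hH).inv⟩

/-- The subgroup `Stab_O(H)` of all elements of `O ≤ Out(A)` that stabilise `H`. -/
def stab (O : Subgroup (Out A)) (H : Subgroup A) : Subgroup O where
  carrier := {Φ | Stabilises (Φ : Out A) H}
  mul_mem' h₁ h₂ := Stabilises.mul h₁ h₂
  one_mem' := .one H
  inv_mem' h := Stabilises.inv h

end Outer

/-! ### Conjugacy classes of subgroups -/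

section ConjClasses

variable {A : Type*} [Group A]

variable (A) in
/-- Conjugacy of subgroups. -/
def conjSetoid : Setoid (Subgroup A) where
  r B C := ∃ g : A, MulAut.conj g • B = C
  iseqv :=
    { refl := fun B => ⟨1, by rw [map_one, one_smul]⟩
      symm := by
        rintro B _ ⟨g, rfl⟩
        exact ⟨g⁻¹, by rw [smul_smul, ← map_mul, inv_mul_cancel, map_one, one_smul]⟩
      trans := by
        rintro B _ _ ⟨g, rfl⟩ ⟨h, rfl⟩
        exact ⟨h * g, by rw [smul_smul, ← map_mul]⟩ }

variable (A) in
/-- The set of conjugacy classes of subgroups of `A`. -/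
def SubgroupClass : Type _ := Quotient (conjSetoid A)

/-- The conjugacy class `[B]` of a subgroup `B`. -/
def cls (B : Subgroup A) : SubgroupClass A := Quotient.mk (conjSetoid A) B

theorem cls_eq_iff {B C : Subgroup A} : cls B = cls C ↔ ∃ g : A, MulAut.conj g • B = C :=
  Quotient.eq (r := conjSetoid A)

/-- `[B] ≤ [C]` iff, up to conjugacy, `B` is contained in `C`. -/
instance : Preorder (SubgroupClass A) where
  le b c := ∃ B C : Subgroup A, cls B = b ∧ cls C = c ∧ B ≤ C
  le_refl b := by
    obtain ⟨B, rfl⟩ := Quotient.exists_rep b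
    exact ⟨B, B, rfl, rfl, le_rfl⟩
  le_trans := by
    rintro _ _ _ ⟨B, C, rfl, rfl, h₁⟩ ⟨C', D, h, rfl, h₂⟩
    obtain ⟨g, rfl⟩ := cls_eq_iff.1 h
    exact ⟨B, MulAut.conj g • D, rfl, (cls_eq_iff.2 ⟨g, rfl⟩).symm,
      h₁.trans (Subgroup.pointwise_smul_le_pointwise_smul_iff.2 h₂)⟩

theorem cls_le_iff {B C : Subgroup A} : cls B ≤ cls C ↔ ∃ g : A, MulAut.conj g • B ≤ C := by
  constructor
  · rintro ⟨B', C', hB, hC, h⟩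
    obtain ⟨g, rfl⟩ := cls_eq_iff.1 hB.symm
    obtain ⟨k, rfl⟩ := cls_eq_iff.1 hC
    exact ⟨k * g, by
      rw [map_mul, mul_smul]; exact Subgroup.pointwise_smul_le_pointwise_smul_iff.2 h⟩
  · rintro ⟨g, h⟩
    exact ⟨_, C, (cls_eq_iff.2 ⟨g, rfl⟩).symm, rfl, h⟩

theorem smul_conj_smul (φ : MulAut A) (g : A) (B : Subgroup A) :
    φ • MulAut.conj g • B = MulAut.conj (φ g) • φ • B := by
  rw [← mul_conj_mul_inv, smul_smul, smul_smul, inv_mul_cancel_right]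

/-- `Aut(A)` acts on conjugacy classes of subgroups by `φ • [B] = [φ(B)]`. -/
def autSMul (φ : MulAut A) : SubgroupClass A → SubgroupClass A :=
  Quotient.lift (fun B => cls (φ • B)) (by
    rintro B _ ⟨g, rfl⟩
    exact cls_eq_iff.2 ⟨φ g, (smul_conj_smul φ g B).symm⟩)

theorem autSMul_eq_of_toOut_eq {φ ψ : MulAut A} (h : toOut φ = toOut ψ) :
    autSMul φ = autSMul ψ := by
  obtain ⟨g, hg⟩ := QuotientGroup.eq.1 h
  have hψ : ψ = φ * MulAut.conj g := by rw [hg, mul_inv_cancel_left]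
  funext b
  obtain ⟨B, rfl⟩ := Quotient.exists_rep b
  exact cls_eq_iff.2 ⟨φ g, by rw [hψ, mul_smul, smul_conj_smul]⟩

/-- `Out(A)` acts on conjugacy classes of subgroups by `[φ] • [B] = [φ(B)]`. -/
instance outAction : MulAction (Out A) (SubgroupClass A) where
  smul Φ b := Quotient.lift (fun φ : MulAut A => autSMul φ b)
    (fun _ _ h => congrFun (autSMul_eq_of_toOut_eq (Quotient.sound h)) b) Φ
  one_smul b := by
    obtain ⟨B, rfl⟩ := Quotient.exists_rep b
    exact congrArg cls (one_smul (MulAut A) B)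
  mul_smul Φ Ψ b := by
    obtain ⟨φ, rfl⟩ := QuotientGroup.mk_surjective Φ
    obtain ⟨ψ, rfl⟩ := QuotientGroup.mk_surjective Ψ
    obtain ⟨B, rfl⟩ := Quotient.exists_rep b
    exact congrArg cls (mul_smul φ ψ B)

theorem toOut_smul_cls (φ : MulAut A) (B : Subgroup A) : toOut φ • cls B = cls (φ • B) := rfl

end ConjClasses

/-! ### Free factors and the relative free factor complex -/

section FreeFactors

variable {A : Type*} [Group A]

/-- `A` is the (internal) free product `B ∗ C` of its subgroups `B` and `C`. -/
def IsFreeProduct (B C : Subgroup A) : Prop :=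
  Function.Bijective (Monoid.Coprod.lift B.subtype C.subtype)

/-- `B` is a free factor of `A`: there is a subgroup `C` with `A = B ∗ C`. -/
def IsFreeFactor (B : Subgroup A) : Prop := ∃ C : Subgroup A, IsFreeProduct B C

/-- `A` is the (internal) free product `F ∗ A₁ ∗ ⋯ ∗ A_k` of the subgroups `𝒜 j` and of a free
subgroup `F` with basis `x`. -/
def IsFreeProductDecomposition {n k : ℕ} (x : Fin n → A) (𝒜 : Fin k → Subgroup A) : Prop :=
  Function.Bijective (Monoid.Coprod.lift (FreeGroup.lift x)
    (Monoid.CoprodI.lift fun j => (𝒜 j).subtype))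

theorem IsFreeFactor.smul {B : Subgroup A} (hB : IsFreeFactor B) (φ : MulAut A) :
    IsFreeFactor (φ • B) := by
  obtain ⟨C, hC⟩ := hB
  refine ⟨φ • C, ?_⟩
  let eB : B ≃* (φ • B : Subgroup A) := Subgroup.equivSMul φ B
  let eC : C ≃* (φ • C : Subgroup A) := Subgroup.equivSMul φ C
  have key : (Monoid.Coprod.lift (φ • B).subtype (φ • C).subtype).comp
      (MulEquiv.coprodCongr eB eC).toMonoidHom
      = φ.toMonoidHom.comp (Monoid.Coprod.lift B.subtype C.subtype) := by
    ext a <;> rfl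
  have h : Function.Bijective
      ((Monoid.Coprod.lift (φ • B).subtype (φ • C).subtype) ∘ (MulEquiv.coprodCongr eB eC)) := by
    have := congrArg DFunLike.coe key
    simp only [MonoidHom.coe_comp] at this
    exact this ▸ (MulEquiv.bijective φ).comp hC
  exact (Function.Bijective.of_comp_iff _ (MulEquiv.bijective _)).1 h

/-- A conjugate of a free factor `B` that is contained in `B` equals `B`. -/
theorem IsFreeFactor.conj_eq {B : Subgroup A} (hB : IsFreeFactor B) {g : A}
    (h : MulAut.conj g • B ≤ B) : MulAut.conj g • B = B := by
  obtain ⟨C, hC⟩ := hB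
  let e := MulEquiv.ofBijective (Monoid.Coprod.lift B.subtype C.subtype) hC
  let r : A →* B := (Monoid.Coprod.lift (MonoidHom.id B) 1).comp e.symm.toMonoidHom
  have hr : ∀ b : B, r b = b := by
    intro b
    have : e.symm b = Monoid.Coprod.inl b := by
      rw [MulEquiv.symm_apply_eq]; exact (Monoid.Coprod.lift_apply_inl B.subtype C.subtype b).symm
    change Monoid.Coprod.lift (MonoidHom.id B) 1 (e.symm b) = b
    rw [this]; simp
  refine le_antisymm h fun b hb => ?_
  have hb' : ((r g)⁻¹ * ⟨b, hb⟩ * r g : B).1 ∈ B := Subtype.property _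
  have h1 : g * ((r g)⁻¹ * ⟨b, hb⟩ * r g : B).1 * g⁻¹ ∈ B :=
    h (Subgroup.smul_mem_pointwise_smul _ (MulAut.conj g) B hb')
  have h2 := congrArg Subtype.val (hr ⟨_, h1⟩)
  simp only [map_mul, hr, map_inv] at h2
  have h3 : g * ((r g)⁻¹ * ⟨b, hb⟩ * r g : B).1 * g⁻¹ = b := by
    rw [← h2]; simp [mul_assoc]
  have h4 := Subgroup.smul_mem_pointwise_smul _ (MulAut.conj g) B hb'
  rwa [MulAut.smul_def, MulAut.conj_apply, h3] at h4

/-- The set `ℱ(A; 𝒜)` of all conjugacy classes `[B]` of proper free factors `B` of `A` that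
properly contain a free factor `B'` of `A` with `[H] ≤ [B']` for all `H ∈ 𝒜`. -/
def RelFreeFactor (𝒜 : Set (Subgroup A)) : Type _ :=
  {b : SubgroupClass A // ∃ B : Subgroup A, cls B = b ∧ IsFreeFactor B ∧ B ≠ ⊤ ∧
    ∃ B' : Subgroup A, IsFreeFactor B' ∧ (∀ H ∈ 𝒜, cls H ≤ cls B') ∧ B' < B}

/-- The partial order on `ℱ(A; 𝒜)` is the one on conjugacy classes of subgroups. -/
instance relFreeFactorOrder (𝒜 : Set (Subgroup A)) : PartialOrder (RelFreeFactor 𝒜) where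
  le b c := b.1 ≤ c.1
  le_refl b := le_refl b.1
  le_trans b c d := le_trans (a := b.1) (b := c.1) (c := d.1)
  le_antisymm := by
    rintro ⟨_, B, rfl, hB, _⟩ ⟨_, C, rfl, _⟩ h₁ h₂
    obtain ⟨g, hg⟩ := cls_le_iff.1 h₁
    obtain ⟨k, hk⟩ := cls_le_iff.1 h₂
    have hgk : MulAut.conj k • MulAut.conj g • B ≤ MulAut.conj k • C :=
      Subgroup.pointwise_smul_le_pointwise_smul_iff.2 hg
    have heq : MulAut.conj (k * g) • B = B :=
      hB.conj_eq (by rw [map_mul, mul_smul]; exact hgk.trans hk)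
    rw [← mul_smul, ← map_mul, heq] at hgk
    exact Subtype.ext (cls_eq_iff.2 ⟨k, le_antisymm hk hgk⟩).symm

theorem ActsTrivially.smul_cls {Φ : Out A} {H : Subgroup A} (h : ActsTrivially Φ H) :
    Φ • cls H = cls H := by
  obtain ⟨φ, rfl, hφ⟩ := h
  rw [toOut_smul_cls]
  congr 1
  ext a
  constructor
  · rintro ⟨b, hb, rfl⟩
    change φ b ∈ H
    rwa [hφ b hb]
  · exact fun ha => ⟨a, ha, hφ a ha⟩

/-- `Out(A; 𝒜ᵗ)` acts on `ℱ(A; 𝒜)` by `[φ] • [B] = [φ(B)]`. -/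
instance relFreeFactorAction (𝒜 : Set (Subgroup A)) :
    MulAction (relOut ∅ 𝒜) (RelFreeFactor 𝒜) where
  smul Φ b := ⟨(Φ : Out A) • b.1, by
    obtain ⟨Φ, hΦ⟩ := Φ
    obtain ⟨_, B, rfl, hB, hBtop, B', hB', h𝒜, hlt⟩ := b
    obtain ⟨φ, rfl⟩ := QuotientGroup.mk_surjective Φ
    refine ⟨φ • B, rfl, hB.smul φ, fun h => hBtop ?_, φ • B', hB'.smul φ, fun H hH => ?_, ?_⟩
    · rw [← inv_smul_smul φ B, h]
      exact eq_top_iff.2 fun a _ => ⟨φ a, trivial, by simp⟩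
    · obtain ⟨g, hg⟩ := cls_le_iff.1 (h𝒜 H hH)
      rw [← (hΦ.2 H hH).smul_cls]
      exact cls_le_iff.2 ⟨φ g, by
        rw [← smul_conj_smul]; exact Subgroup.pointwise_smul_le_pointwise_smul_iff.2 hg⟩
    · exact lt_of_le_not_ge (Subgroup.pointwise_smul_le_pointwise_smul_iff.2 hlt.le)
        fun h => hlt.not_ge (Subgroup.pointwise_smul_le_pointwise_smul_iff.1 h)⟩
  one_smul b := Subtype.ext (one_smul (Out A) b.1)
  mul_smul Φ Ψ b := Subtype.ext (mul_smul (Φ : Out A) (Ψ : Out A) b.1)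

/-- The free factor complex of `A` relative to `𝒜`. -/
def freeFactorComplex (𝒜 : Set (Subgroup A)) : AbstractSimplicialComplex (RelFreeFactor 𝒜) :=
  orderComplex (RelFreeFactor 𝒜)

/-- The subgroup `S_i = ⟨x₁, …, x_i⟩ ∗ A₁ ∗ ⋯ ∗ A_k` of `A`; the basis element `x_{j+1}` is
`x j` with `j : Fin n`. -/
def standardFactor {n k : ℕ} (x : Fin n → A) (𝒜 : Fin k → Subgroup A) (i : ℕ) : Subgroup A :=
  Subgroup.closure {a | ∃ j : Fin n, (j : ℕ) < i ∧ x j = a} ⊔ ⨆ j, 𝒜 j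

/-- The family `𝒫` of the maximal standard parabolic subgroups `P_i = Stab_O(S_i)`,
`1 ≤ i ≤ n - 1`, of `O = Out(A; {A₁, …, A_k}ᵗ)`. -/
def parabolics {n k : ℕ} (x : Fin n → A) (𝒜 : Fin k → Subgroup A) :
    Set (Subgroup (relOut ∅ (Set.range 𝒜))) :=
  {P | ∃ i : ℕ, 1 ≤ i ∧ i < n ∧ P = stab (relOut ∅ (Set.range 𝒜)) (standardFactor x 𝒜 i)}

end FreeFactors

end RelFF

/-! `P_i` is the stabiliser in `O` of the vertex `[S_i]` (`mem_stab_iff`). If every vertex has the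
form `b = Φ[S_i]` with a unique `i`, and the `P_i` are pairwise distinct, then `b ↦ Φ P_i` is a
bijection from the vertices onto the cosets. The coset of `b` is intrinsically `carrierSet x b`, so
equivariance is immediate, and vertices span a simplex of the coset complex iff a single `Φ` carries
standard vertices to all of them. Such vertices form a chain because the `S_i` are nested. The main
content is the converse: every finite chain is translated into standard position by one `Φ`.

This rests on a relative Kurosh theorem. A free factor `C` that contains conjugates of all `A_j` is
the free product of these (suitably chosen) conjugates and a free group
(`IsFreeFactor.exists_isRelBasis`), and a relative basis of a free factor `B ≤ C` extends to one of
`C` (`IsRelBasis.exists_append`). Both follow from `exists_stabilizer_splitting` for the action of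
`A` on `A ⧸ C`; the complementary factor is free because it embeds into `F_n`
(`exists_basis_of_complement`). Extending along a chain up to `A` gives one relative basis adapted
to the whole chain. The automorphism that matches it with the given basis lies in `O`, since it
conjugates each `A_j` (`exists_mulAut_of_isRelBasis`).

Indices are recovered by an invariant: `2 ^ (n - i)` homomorphisms to the group of order two kill
all `A_j` and `S_i`, and `O` preserves this count (`standardFactor_index_eq`). Transposing two
adjacent basis elements separates the `P_i` (`eq_of_stab_standardFactor_eq`). -/

namespace RelFF

open Monoid Function

/-! ### Splitting off fixed vertex groups from point stabilisers -/

section SplitOff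

variable {G F J X : Type*} [Group G] [Group F] {H : J → Type*} [∀ j, Group (H j)]
  [MulAction G X]

theorem freeProduct_induction {f : F →* G} {g : ∀ j, H j →* G}
    (hfg : Surjective (Coprod.lift f (CoprodI.lift g))) {P : G → Prop}
    (hf : ∀ a, P (f a)) (hg : ∀ j a, P (g j a)) (hmul : ∀ u v, P u → P v → P (u * v)) (u : G) :
    P u := by
  obtain ⟨w, rfl⟩ := hfg u
  induction w using Coprod.induction_on with
  | inl a => simpa using hf a
  | inr b =>
    rw [Coprod.lift_apply_inr]
    induction b using CoprodI.induction_on with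
    | one => simpa using hf 1
    | of j a => simpa using hg j a
    | mul a b ha hb => rw [map_mul]; exact hmul _ _ ha hb
  | mul a b ha hb => rw [map_mul]; exact hmul _ _ ha hb

/-- `Avoids f g xs u x`: the element `u` is a product of elements of the factors which, when applied
to `x` letter by letter, never applies an element of the `j`-th factor at its fixed point `xs j`. -/
inductive Avoids (f : F →* G) (g : ∀ j, H j →* G) (xs : J → X) : G → X → Prop
  | one (x : X) : Avoids f g xs 1 x
  | free (a : F) {u : G} {x : X} : Avoids f g xs u x → Avoids f g xs (f a * u) x
  | vertex (j : J) (a : H j) {u : G} {x : X} : u • x ≠ xs j → Avoids f g xs u x →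
      Avoids f g xs (g j a * u) x

variable {f : F →* G} {g : ∀ j, H j →* G} {xs : J → X}

theorem Avoids.mul {u v : G} {x : X} (hv : Avoids f g xs v (u • x)) (hu : Avoids f g xs u x) :
    Avoids f g xs (v * u) x := by
  generalize hy : u • x = y at hv
  induction hv with
  | one => simpa using hu
  | free a _ ih => rw [mul_assoc]; exact .free a (ih hy)
  | vertex j a h _ ih =>
    subst hy
    rw [mul_assoc]; exact .vertex j a (by rwa [mul_smul]) (ih rfl)

theorem avoids_free (a : F) (x : X) : Avoids f g xs (f a) x := by
  simpa using Avoids.free (f := f) (g := g) (xs := xs) a (.one x)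

theorem avoids_vertex {j : J} (a : H j) {x : X} (hx : x ≠ xs j) : Avoids f g xs (g j a) x := by
  simpa using Avoids.vertex (f := f) (g := g) (xs := xs) j a (by simpa using hx) (.one x)

theorem smul_ne_of_fixed (hfix : ∀ j a, g j a • xs j = xs j) {j : J} (a : H j) {x : X}
    (hx : x ≠ xs j) : g j a • x ≠ xs j := fun h =>
  hx (smul_left_cancel (g j a) (h.trans (hfix j a).symm))

theorem Avoids.inv (hfix : ∀ j a, g j a • xs j = xs j) {u : G} {x : X}
    (hu : Avoids f g xs u x) : Avoids f g xs u⁻¹ (u • x) := by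
  induction hu with
  | one => simpa using Avoids.one _
  | @free a u x _ ih =>
    rw [mul_inv_rev, ← map_inv]
    refine .mul ?_ (avoids_free _ _)
    simpa [mul_smul] using ih
  | @vertex j a u x h _ ih =>
    rw [mul_inv_rev, ← map_inv]
    refine .mul ?_ (avoids_vertex _ ?_)
    · simpa [mul_smul] using ih
    · rw [mul_smul]; exact smul_ne_of_fixed hfix a h

/-- A letter of `H j` met at its fixed point does not move it, so it can be deleted from a word
without changing where the word leads. -/
theorem exists_avoids [MulAction.IsPretransitive G X]
    (hfg : Surjective (Coprod.lift f (CoprodI.lift g))) (hfix : ∀ j a, g j a • xs j = xs j)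
    (x y : X) : ∃ u, Avoids f g xs u x ∧ u • x = y := by
  obtain ⟨v, rfl⟩ := MulAction.exists_smul_eq G x y
  revert x
  refine freeProduct_induction hfg (P := fun v => ∀ x, ∃ u, Avoids f g xs u x ∧ u • x = v • x)
    (fun a x => ⟨f a, avoids_free a x, rfl⟩) (fun j a x => ?_) (fun u v hu hv x => ?_) v
  · by_cases hx : x = xs j
    · exact ⟨1, .one x, by rw [hx, hfix, one_smul]⟩
    · exact ⟨g j a, avoids_vertex a hx, rfl⟩
  · obtain ⟨v', hv', hvx⟩ := hv x
    obtain ⟨u', hu', hux⟩ := hu (v • x)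
    exact ⟨u' * v', .mul (by rwa [hvx]) hv', by rw [mul_smul, hvx, hux, mul_smul]⟩

variable (f) in
/-- The elements of the stabiliser of `x₀` that avoid the fixed points `xs j`. -/
def avoidingStabilizer (hfix : ∀ j a, g j a • xs j = xs j) (x₀ : X) : Subgroup G where
  carrier := {u | Avoids f g xs u x₀ ∧ u • x₀ = x₀}
  mul_mem' := fun {u v} hu hv => ⟨.mul (by rw [hv.2]; exact hu.1) hv.1, by
    rw [mul_smul, hv.2, hu.2]⟩
  one_mem' := ⟨.one x₀, one_smul _ _⟩
  inv_mem' := fun {u} hu => ⟨by simpa only [hu.2] using hu.1.inv hfix, by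
    rw [inv_smul_eq_iff, hu.2]⟩

open Classical in
/-- The stabiliser of a point `x₀` in a transitive action of a free product splits as a free
product in which conjugates of those factors with a chosen fixed point appear as factors. -/
theorem exists_stabilizer_splitting [MulAction.IsPretransitive G X]
    (hfg : Bijective (Coprod.lift f (CoprodI.lift g))) (hfix : ∀ j a, g j a • xs j = xs j)
    (x₀ : X) :
    ∃ (K : Subgroup G) (p : J → G), (∀ j, p j • x₀ = xs j) ∧ (∀ j, xs j = x₀ → p j = 1) ∧
      Injective (Coprod.lift K.subtype
        (CoprodI.lift fun j => (MulAut.conj (p j)⁻¹).toMonoidHom.comp (g j))) ∧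
      (Coprod.lift K.subtype
        (CoprodI.lift fun j => (MulAut.conj (p j)⁻¹).toMonoidHom.comp (g j))).range =
        MulAction.stabilizer G x₀ := by
  -- A transversal of avoiding elements, normalised to be `1` at the base point.
  have hp : ∀ x : X, ∃ u, (Avoids f g xs u x₀ ∧ u • x₀ = x) ∧ (x = x₀ → u = 1) := by
    intro x
    by_cases hx : x = x₀
    · exact ⟨1, ⟨.one _, by rw [hx, one_smul]⟩, fun _ => rfl⟩
    · obtain ⟨u, hu⟩ := exists_avoids hfg.2 hfix x₀ x
      exact ⟨u, hu, fun h => absurd h hx⟩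
  choose p hp hp1 using hp
  have hpA : ∀ x, Avoids f g xs (p x) x₀ := fun x => (hp x).1
  have hpx : ∀ x, p x • x₀ = x := fun x => (hp x).2
  have hpi : ∀ x, (p x)⁻¹ • x = x₀ := fun x => by rw [inv_smul_eq_iff, hpx]
  have hp0 : p x₀ = 1 := hp1 x₀ rfl
  set K := avoidingStabilizer f hfix x₀
  have hmem : ∀ {u : G} {x : X}, Avoids f g xs u x → (p (u • x))⁻¹ * u * p x ∈ K := by
    intro u x hu
    refine ⟨.mul (.mul ?_ ?_) (hpA x), ?_⟩
    · have := (hpA (u • x)).inv hfix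
      rw [hpx] at this ⊢
      exact this
    · rwa [hpx]
    · rw [mul_smul, mul_smul, hpx, hpi]
  -- The loop at `x₀` along `p x`, then `u`, then back. The default `1` is never relevant: `κ` is
  -- only evaluated at avoiding pairs.
  let κ : G → X → K := fun u x =>
    if h : Avoids f g xs u x then ⟨(p (u • x))⁻¹ * u * p x, hmem h⟩ else 1
  have hκ : ∀ {u : G} {x : X}, Avoids f g xs u x → (κ u x : G) = (p (u • x))⁻¹ * u * p x :=
    fun h => by simp only [κ, dif_pos h]
  have hκmul : ∀ {u v : G} {x : X}, Avoids f g xs u (v • x) → Avoids f g xs v x →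
      κ (u * v) x = κ u (v • x) * κ v x := by
    intro u v x hu hv
    apply Subtype.ext
    rw [Subgroup.coe_mul, hκ hu, hκ hv, hκ (hu.mul hv), mul_smul]
    group
  -- The inverse of the map from `L` to the stabiliser is obtained from a cocycle `c : G → X → L`.
  -- Such a cocycle amounts to a homomorphism `G → (X → L) ⋊ G` over `G`, which may be prescribed
  -- independently on the free factors of `G`.
  let L := Coprod K (CoprodI H)
  have harrow : ∀ (u : G) (φ : X → L) (x : X), mulAutArrow u φ x = φ (u⁻¹ • x) :=
    fun _ _ _ => rfl
  let ΘF : F →* (X → L) ⋊[mulAutArrow] G := MonoidHom.mk'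
    (fun a => ⟨fun x => Coprod.inl (κ (f a) ((f a)⁻¹ • x)), f a⟩) (by
      intro a b
      refine SemidirectProduct.ext ?_ (map_mul f a b)
      funext x
      have := hκmul (avoids_free (f := f) (g := g) (xs := xs) a (f b • (f b)⁻¹ • (f a)⁻¹ • x))
        (avoids_free b _)
      simp only [SemidirectProduct.mul_left, Pi.mul_apply, harrow, map_mul,
        mul_inv_rev, mul_smul, this]
      rw [smul_inv_smul])
  -- Here `x` is the point at which the letter arrives. It equals `xs j` exactly when the departure
  -- point does (`hinv`), so the two cases are compatible with products in `H j`.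
  let ν : ∀ j, H j → X → L := fun j a x =>
    if x = xs j then Coprod.inr (CoprodI.of a) else Coprod.inl (κ (g j a) ((g j a)⁻¹ • x))
  have hinv : ∀ j (a : H j) x, (g j a)⁻¹ • x = xs j ↔ x = xs j := by
    intro j a x
    rw [inv_smul_eq_iff, hfix]
  let ΘH : ∀ j, H j →* (X → L) ⋊[mulAutArrow] G := fun j => MonoidHom.mk'
    (fun a => ⟨ν j a, g j a⟩) (by
      intro a b
      refine SemidirectProduct.ext ?_ (map_mul (g j) a b)
      funext x
      simp only [SemidirectProduct.mul_left, Pi.mul_apply, harrow, ν, hinv]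
      by_cases hx : x = xs j
      · simp only [if_pos hx, map_mul]
      · have h1 : (g j a)⁻¹ • x ≠ xs j := (hinv j a x).not.2 hx
        have h2 : (g j b)⁻¹ • (g j a)⁻¹ • x ≠ xs j := (hinv j b _).not.2 h1
        have := hκmul (u := g j a) (v := g j b) (avoids_vertex (f := f) (g := g) a
          (by rwa [smul_inv_smul])) (avoids_vertex b h2)
        simp only [if_neg hx, map_mul, mul_inv_rev, mul_smul, this]
        rw [smul_inv_smul])
  let e := MulEquiv.ofBijective _ hfg
  let Θ : G →* (X → L) ⋊[mulAutArrow] G :=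
    (Coprod.lift ΘF (CoprodI.lift ΘH)).comp e.symm.toMonoidHom
  have heF : ∀ a, e.symm (f a) = Coprod.inl a := fun a => by
    rw [MulEquiv.symm_apply_eq]
    exact (Coprod.lift_apply_inl f (CoprodI.lift g) a).symm
  have heH : ∀ j a, e.symm (g j a) = Coprod.inr (CoprodI.of a) := fun j a => by
    rw [MulEquiv.symm_apply_eq]
    exact (by simp : Coprod.lift f (CoprodI.lift g) (Coprod.inr (CoprodI.of a)) = g j a).symm
  have hΘF : ∀ a, Θ (f a) = ΘF a := fun a => by
    change Coprod.lift ΘF (CoprodI.lift ΘH) (e.symm (f a)) = _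
    rw [heF, Coprod.lift_apply_inl]
  have hΘH : ∀ j a, Θ (g j a) = ΘH j a := fun j a => by
    change Coprod.lift ΘF (CoprodI.lift ΘH) (e.symm (g j a)) = _
    rw [heH, Coprod.lift_apply_inr, CoprodI.lift_of]
  have hΘr : ∀ u, (Θ u).right = u := by
    refine freeProduct_induction hfg.2 (fun a => ?_) (fun j a => ?_) (fun u v hu hv => ?_)
    · rw [hΘF]; rfl
    · rw [hΘH]; rfl
    · rw [map_mul, SemidirectProduct.mul_right, hu, hv]
  -- Evaluation at `u • x` passes from indexing by the arrival point to indexing by the departure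
  -- point.
  let c : G → X → L := fun u x => (Θ u).left (u • x)
  have hcmul : ∀ u v x, c (u * v) x = c u (v • x) * c v x := by
    intro u v x
    simp only [c, map_mul, SemidirectProduct.mul_left, Pi.mul_apply, harrow, hΘr,
      mul_smul, inv_smul_smul]
  have hcF : ∀ a x, c (f a) x = Coprod.inl (κ (f a) x) := fun a x => by
    simp only [c, hΘF]
    change Coprod.inl (κ (f a) ((f a)⁻¹ • f a • x)) = _
    rw [inv_smul_smul]
  have hcH1 : ∀ j a, c (g j a) (xs j) = Coprod.inr (CoprodI.of a) := fun j a => by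
    simp only [c, hΘH]
    change ν j a _ = _
    simp only [ν, hfix, if_true]
  have hcH2 : ∀ j a x, x ≠ xs j → c (g j a) x = Coprod.inl (κ (g j a) x) := fun j a x hx => by
    simp only [c, hΘH]
    change ν j a _ = _
    simp only [ν, if_neg (smul_ne_of_fixed hfix a hx), inv_smul_smul]
  have hcone : ∀ x, c 1 x = 1 := fun x => by
    have := hcmul 1 1 x
    rw [one_mul, one_smul] at this
    exact left_eq_mul.1 this
  have hcinv : ∀ u x, c u⁻¹ (u • x) = (c u x)⁻¹ := fun u x => by
    rw [eq_inv_iff_mul_eq_one, ← hcmul, inv_mul_cancel, hcone]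
  -- Along an avoiding word no letter of `H j` is read at `xs j`, so the cocycle stays in `K`.
  have hcA : ∀ {u x}, Avoids f g xs u x → c u x = Coprod.inl (κ u x) := by
    intro u x hu
    induction hu with
    | one x =>
      have : κ 1 x = 1 := Subtype.ext (by rw [hκ (.one x)]; simp)
      rw [hcone, this, map_one]
    | free a hu ih => rw [hcmul, hcF, ih, hκmul (avoids_free _ _) hu, map_mul]
    | vertex j a hx hu ih =>
      rw [hcmul, hcH2 _ _ _ hx, ih, hκmul (avoids_vertex _ hx) hu, map_mul]
  have hcp : ∀ x, c (p x) x₀ = 1 := fun x => by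
    have : κ (p x) x₀ = 1 := Subtype.ext (by
      rw [hκ (hpA x), hpx, hp0]; simp)
    rw [hcA (hpA x), this, map_one]
  have hcK : ∀ k : K, c k x₀ = Coprod.inl k := fun k => by
    have : κ k x₀ = k := Subtype.ext (by
      rw [hκ k.2.1, k.2.2, hp0]; simp)
    rw [hcA k.2.1, this]
  refine ⟨K, fun j => p (xs j), fun j => hpx _, fun j => hp1 _, ?_, ?_⟩
  all_goals
    set θ := Coprod.lift K.subtype
      (CoprodI.lift fun j => (MulAut.conj (p (xs j))⁻¹).toMonoidHom.comp (g j)) with hθ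
    have hθK : ∀ k : K, θ (Coprod.inl k) = k := fun k => Coprod.lift_apply_inl _ _ _
    have hθH : ∀ j a, θ (Coprod.inr (CoprodI.of (i := j) a)) = (p (xs j))⁻¹ * g j a * p (xs j) :=
      fun j a => by simp [hθ]
    have hθx : ∀ w, θ w • x₀ = x₀ := by
      intro w
      induction w using Coprod.induction_on with
      | inl k => rw [hθK]; exact k.2.2
      | inr b =>
        induction b using CoprodI.induction_on with
        | one => simp
        | of j a => rw [hθH, mul_smul, mul_smul, hpx, hfix, hpi]
        | mul a b ha hb => rw [map_mul, map_mul, mul_smul, hb, ha]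
      | mul a b ha hb => rw [map_mul, mul_smul, hb, ha]
  · have hleft : LeftInverse (fun u => c u x₀) θ := by
      intro w
      change c (θ w) x₀ = w
      induction w using Coprod.induction_on with
      | inl k => rw [hθK, hcK]
      | inr b =>
        induction b using CoprodI.induction_on with
        | one => simp [hcone]
        | of j a =>
          have h1 : c (p (xs j))⁻¹ (xs j) = 1 := by
            have := hcinv (p (xs j)) x₀
            rwa [hpx, hcp, inv_one] at this
          rw [hθH, hcmul, hcmul, hpx, hfix, h1, hcH1, hcp, mul_one, one_mul]
        | mul a b ha hb => rw [map_mul, map_mul, hcmul, hθx, ha, hb]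
      | mul a b ha hb => rw [map_mul, hcmul, hθx, ha, hb]
    exact hleft.injective
  -- Both sides are multiplicative along products, so it suffices to check letters. For `u` fixing
  -- `x₀` the right side at `x₀` is `u`, which gives surjectivity onto the stabiliser.
  · have hθc : ∀ u x, θ (c u x) = (p (u • x))⁻¹ * u * p x := by
      refine freeProduct_induction hfg.2 (fun a x => ?_) (fun j a x => ?_)
        (fun u v hu hv x => ?_)
      · rw [hcF, hθK, hκ (avoids_free _ _)]
      · by_cases hx : x = xs j
        · rw [hx, hcH1, hθH, hfix]
        · rw [hcH2 _ _ _ hx, hθK, hκ (avoids_vertex _ hx)]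
      · rw [hcmul, map_mul, hu, hv, mul_smul]; group
    ext u
    constructor
    · rintro ⟨w, rfl⟩
      exact hθx w
    · intro hu
      have hu : u • x₀ = x₀ := hu
      exact ⟨c u x₀, by rw [hθc, hu, hp0]; simp⟩

end SplitOff

/-! ### Free products of homomorphisms -/

section Lifts

variable {A P Q R : Type*} [Group A] [Group P] [Group Q] [Group R]

theorem range_comp_of_surjective (α : Q →* A) {β : P →* Q} (hβ : Surjective β) :
    (α.comp β).range = α.range := by
  rw [MonoidHom.range_comp, MonoidHom.range_eq_top.2 hβ, MonoidHom.range_eq_map]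

theorem injective_of_coprod_lift_left {α : P →* A} {β : R →* A}
    (h : Injective (Coprod.lift α β)) : Injective α := by
  have := h.comp Coprod.inl_injective
  rwa [← MonoidHom.coe_comp, Coprod.lift_comp_inl] at this

theorem injective_of_coprod_lift_right {α : P →* A} {β : R →* A}
    (h : Injective (Coprod.lift α β)) : Injective β := by
  have := h.comp Coprod.inr_injective
  rwa [← MonoidHom.coe_comp, Coprod.lift_comp_inr] at this

/-- Injectivity of a homomorphism from a free product depends only on the images of the factors,
as long as the factors embed. -/
theorem injective_coprod_lift_range_iff {α : P →* A} {β : R →* A} (hα : Injective α)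
    (hβ : Injective β) :
    Injective (Coprod.lift α.range.subtype β.range.subtype) ↔ Injective (Coprod.lift α β) := by
  have key : Coprod.lift α β = (Coprod.lift α.range.subtype β.range.subtype).comp
      (MulEquiv.coprodCongr (MonoidHom.ofInjective hα) (MonoidHom.ofInjective hβ)).toMonoidHom := by
    ext a <;> rfl
  rw [key, MonoidHom.coe_comp]
  exact (Injective.of_comp_iff' _ (MulEquiv.bijective _)).symm

theorem IsFreeProduct.of_lift {α : P →* A} {β : R →* A} (h : Bijective (Coprod.lift α β)) :
    IsFreeProduct α.range β.range := by
  refine ⟨(injective_coprod_lift_range_iff (injective_of_coprod_lift_left h.1)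
    (injective_of_coprod_lift_right h.1)).2 h.1, ?_⟩
  rw [← MonoidHom.range_eq_top, Coprod.range_lift, Subgroup.range_subtype, Subgroup.range_subtype,
    ← Coprod.range_lift, MonoidHom.range_eq_top]
  exact h.2

/-- Splitting the last `m` letters of a free group off a free product. -/
def coprodAppendEquiv (i m : ℕ) (Q : Type*) [Group Q] :
    Coprod (FreeGroup (Fin (i + m))) Q ≃*
      Coprod (Coprod (FreeGroup (Fin i)) Q) (FreeGroup (Fin m)) :=
  MonoidHom.toMulEquiv
    (Coprod.lift (FreeGroup.lift (Fin.append
      (fun a => Coprod.inl (Coprod.inl (FreeGroup.of a)))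
      (fun b => Coprod.inr (FreeGroup.of b)))) (Coprod.inl.comp Coprod.inr))
    (Coprod.lift (Coprod.lift (Coprod.inl.comp (FreeGroup.map (Fin.castAdd m))) Coprod.inr)
      (Coprod.inl.comp (FreeGroup.map (Fin.natAdd i))))
    (by
      refine Coprod.hom_ext (FreeGroup.ext_hom _ _ fun a => ?_) (by ext; simp)
      refine Fin.addCases (fun a => ?_) (fun a => ?_) a <;> simp)
    (by
      refine Coprod.hom_ext (Coprod.hom_ext (FreeGroup.ext_hom _ _ fun a => ?_) (by ext; simp))
        (FreeGroup.ext_hom _ _ fun a => ?_) <;> simp)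

theorem coprod_lift_append {i m : ℕ} (y : Fin i → A) (z : Fin m → A) (η : Q →* A) :
    Coprod.lift (FreeGroup.lift (Fin.append y z)) η =
      (Coprod.lift (Coprod.lift (FreeGroup.lift y) η) (FreeGroup.lift z)).comp
        (coprodAppendEquiv i m Q).toMonoidHom := by
  refine Coprod.hom_ext (FreeGroup.ext_hom _ _ fun a => ?_) (by ext; simp [coprodAppendEquiv])
  refine Fin.addCases (fun a => ?_) (fun a => ?_) a <;> simp [coprodAppendEquiv]

theorem injective_coprod_lift_append_iff {i m : ℕ} {y : Fin i → A} {z : Fin m → A} {η : Q →* A} :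
    Injective (Coprod.lift (FreeGroup.lift (Fin.append y z)) η) ↔
      Injective (Coprod.lift (Coprod.lift (FreeGroup.lift y) η) (FreeGroup.lift z)) := by
  rw [coprod_lift_append, MonoidHom.coe_comp]
  exact Injective.of_comp_iff' _ (MulEquiv.bijective _)

theorem range_coprod_lift_append {i m : ℕ} (y : Fin i → A) (z : Fin m → A) (η : Q →* A) :
    (Coprod.lift (FreeGroup.lift (Fin.append y z)) η).range =
      (Coprod.lift (Coprod.lift (FreeGroup.lift y) η) (FreeGroup.lift z)).range := by
  rw [coprod_lift_append]
  exact range_comp_of_surjective _ (MulEquiv.surjective (coprodAppendEquiv i m Q))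

/-- The free product over a one-element family. -/
def coprodIUnitEquiv (P : Type*) [Group P] : CoprodI (fun _ : Unit => P) ≃* P :=
  MonoidHom.toMulEquiv (CoprodI.lift fun _ => MonoidHom.id P) (CoprodI.of (M := fun _ : Unit => P) (i := ()))
    (CoprodI.ext_hom _ _ fun _ => by ext; simp) (by ext; simp)

theorem coprod_lift_unit (α : P →* A) (β : R →* A) :
    Coprod.lift β (CoprodI.lift fun _ : Unit => α) = (Coprod.lift α β).comp
      (((MulEquiv.refl R).coprodCongr (coprodIUnitEquiv P)).trans
        (MulEquiv.coprodComm R P)).toMonoidHom := by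
  refine Coprod.hom_ext ?_ (CoprodI.ext_hom _ _ fun _ => ?_)
  · ext a
    change _ = Coprod.lift α β (Coprod.inr a)
    simp
  · ext a
    change _ = Coprod.lift α β (Coprod.inl (coprodIUnitEquiv P (CoprodI.of a)))
    rw [Coprod.lift_apply_inl]
    simp [coprodIUnitEquiv]

/-- Lets `exists_stabilizer_splitting` be applied to a product of two factors, one of which is the
only factor with a chosen fixed point. -/
theorem bijective_coprod_lift_unit_iff {α : P →* A} {β : R →* A} :
    Bijective (Coprod.lift β (CoprodI.lift fun _ : Unit => α)) ↔ Bijective (Coprod.lift α β) := by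
  rw [coprod_lift_unit, MonoidHom.coe_comp]
  exact Bijective.of_comp_iff _ (MulEquiv.bijective _)

theorem injective_coprod_lift_unit_iff {α : P →* A} {β : R →* A} :
    Injective (Coprod.lift β (CoprodI.lift fun _ : Unit => α)) ↔ Injective (Coprod.lift α β) := by
  rw [coprod_lift_unit, MonoidHom.coe_comp]
  exact Injective.of_comp_iff' _ (MulEquiv.bijective _)

theorem range_coprodI_lift_unit (α : P →* A) :
    (CoprodI.lift fun _ : Unit => α).range = α.range := by
  rw [CoprodI.range_eq_iSup, iSup_const]

end Lifts

/-! ### Free complements -/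

section FreeComplement

/-- A finitely generated group that embeds into a free group of finite rank is free of finite
rank. -/
theorem exists_freeGroup_fin_equiv {K : Type*} [Group K] [Group.FG K] {n : ℕ}
    (q : K →* FreeGroup (Fin n)) (hq : Injective q) :
    ∃ m : ℕ, Nonempty (FreeGroup (Fin m) ≃* K) := by
  obtain ⟨ι, ⟨e⟩⟩ : ∃ ι : Type, Nonempty (FreeGroup ι ≃* K) :=
    ⟨_, ⟨(IsFreeGroup.mulEquiv q.range).trans (MonoidHom.ofInjective hq).symm⟩⟩
  -- Finite generation leaves finitely many homomorphisms to `ZMod 2`, while those dual to a basis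
  -- are pairwise distinct; hence the basis is finite.
  have : Finite (K →* Multiplicative (ZMod 2)) := by
    obtain ⟨S, hS⟩ := Group.FG.out (G := K)
    refine Finite.of_injective (β := S → Multiplicative (ZMod 2)) (fun φ s => φ s) ?_
    intro φ ψ h
    exact MonoidHom.eq_of_eqOn_dense hS fun s hs => congrFun h ⟨s, hs⟩
  classical
  have : Finite ι := by
    refine Finite.of_injective (β := K →* Multiplicative (ZMod 2)) (fun i =>
      (FreeGroup.lift (Pi.mulSingle i (Multiplicative.ofAdd 1))).comp e.symm.toMonoidHom) ?_
    intro i j h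
    have := DFunLike.congr_fun h (e (FreeGroup.of i))
    by_contra hij
    simp [Pi.mulSingle_eq_of_ne hij] at this
  obtain ⟨m, ⟨f⟩⟩ := Finite.exists_equiv_fin ι
  exact ⟨m, ⟨(FreeGroup.freeGroupCongr f.symm).trans e⟩⟩

variable {A : Type*} [Group A]

theorem IsFreeFactor.exists_retraction {B : Subgroup A} (hB : IsFreeFactor B) :
    ∃ r : A →* B, ∀ b : B, r b = b := by
  obtain ⟨C, hC⟩ := hB
  let e := MulEquiv.ofBijective (Coprod.lift B.subtype C.subtype) hC
  refine ⟨(Coprod.lift (MonoidHom.id B) 1).comp e.symm.toMonoidHom, fun b => ?_⟩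
  have : e.symm b = Coprod.inl b := by
    rw [MulEquiv.symm_apply_eq]; exact (Coprod.lift_apply_inl B.subtype C.subtype b).symm
  change Coprod.lift (MonoidHom.id B) 1 (e.symm b) = b
  rw [this]; simp

/-- Let `C` be a free factor of `A = F_n ∗ A₁ ∗ ⋯ ∗ A_k`. If `C = K ∗ Q` where `Q` contains
conjugates of all `A_j`, then `K` is free of finite rank. -/
theorem exists_basis_of_complement [Group.FG A] {n k : ℕ} {x : Fin n → A}
    {𝒜 : Fin k → Subgroup A} (hA : IsFreeProductDecomposition x 𝒜) {C K : Subgroup A}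
    (hC : IsFreeFactor C) {Q : Type*} [Group Q] {η : Q →* A}
    (hinj : Injective (Coprod.lift K.subtype η)) (hran : (Coprod.lift K.subtype η).range = C)
    (hQ : ∀ j, ∃ g : A, MulAut.conj g • 𝒜 j ≤ η.range) :
    ∃ (m : ℕ) (z : Fin m → A), Injective (FreeGroup.lift z) ∧ (FreeGroup.lift z).range = K := by
  obtain ⟨r, hr⟩ := hC.exists_retraction
  let e : Coprod K Q ≃* C := (MonoidHom.ofInjective hinj).trans (MulEquiv.subgroupCongr hran)
  -- The retraction `A → C → K`. It kills the image of `η`, which contains a conjugate of each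
  -- `A_j`, hence it kills each `A_j`.
  let ρ : A →* K := (Coprod.fst.comp e.symm.toMonoidHom).comp r
  have hρ : ∀ w, ρ (Coprod.lift K.subtype η w) = Coprod.fst w := by
    intro w
    have h1 : Coprod.lift K.subtype η w = (e w : A) := rfl
    change Coprod.fst (e.symm (r _)) = _
    rw [h1, hr, MulEquiv.symm_apply_apply]
  have hρK : ∀ k : K, ρ k = k := fun k => by simpa using hρ (Coprod.inl k)
  have hρQ : ∀ w, ρ (η w) = 1 := fun w => by simpa using hρ (Coprod.inr w)
  have hρA : ∀ j (a : 𝒜 j), ρ a = 1 := by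
    intro j a
    obtain ⟨g, hg⟩ := hQ j
    obtain ⟨w, hw⟩ := hg (Subgroup.smul_mem_pointwise_smul _ (MulAut.conj g) _ a.2)
    have := hρQ w
    rw [hw, MulAut.smul_def, MulAut.conj_apply, map_mul, map_mul, map_inv] at this
    simpa using this
  have hρs : Surjective ρ := fun k => ⟨k, hρK k⟩
  have : Group.FG K := Group.fg_of_surjective hρs
  let eA := MulEquiv.ofBijective _ hA
  let q : A →* FreeGroup (Fin n) := Coprod.fst.comp eA.symm.toMonoidHom
  -- Killing every `A_j`, `ρ` factors through the projection `q` to `F_n`. Since `ρ` is the identity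
  -- on `K`, `q` must be injective there.
  have hσ : ρ = (ρ.comp (FreeGroup.lift x)).comp q := by
    have : ρ.comp eA.toMonoidHom = (ρ.comp (FreeGroup.lift x)).comp Coprod.fst := by
      refine Coprod.hom_ext (FreeGroup.ext_hom _ _ fun i => ?_)
        (CoprodI.ext_hom _ _ fun j => MonoidHom.ext fun a => ?_)
      · change ρ (Coprod.lift _ _ (Coprod.inl _)) = _
        simp
      · change ρ (Coprod.lift _ _ (Coprod.inr _)) = _
        simpa using hρA j a
    ext a
    obtain ⟨w, rfl⟩ := eA.surjective a
    have := DFunLike.congr_fun this w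
    simp only [MonoidHom.comp_apply, q, MulEquiv.coe_toMonoidHom,
      MulEquiv.symm_apply_apply] at this ⊢
    rw [this]
  have hq : Injective (q.comp K.subtype) := by
    intro a b h
    have h' : q a = q b := h
    rw [← hρK a, ← hρK b, DFunLike.congr_fun hσ (a : A), DFunLike.congr_fun hσ (b : A),
      MonoidHom.comp_apply, h']
    rfl
  obtain ⟨m, ⟨ε⟩⟩ := exists_freeGroup_fin_equiv _ hq
  have hz : FreeGroup.lift (fun i => (ε (FreeGroup.of i) : A)) =
      K.subtype.comp ε.toMonoidHom := by
    refine FreeGroup.ext_hom _ _ fun i => ?_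
    simp
  refine ⟨m, fun i => (ε (FreeGroup.of i) : A), ?_, ?_⟩
  · rw [hz]
    exact Subtype.val_injective.comp ε.injective
  · rw [hz, range_comp_of_surjective _ ε.surjective, Subgroup.range_subtype]

end FreeComplement

/-! ### Relative bases of free factors -/

section RelBasis

variable {A : Type*} [Group A] {k : ℕ} {𝒜 : Fin k → Subgroup A}

variable (𝒜) in
/-- The homomorphism `F_m ∗ A₁ ∗ ⋯ ∗ A_k → A` that sends the basis to `y` and conjugates `A_j` by
`h j`. -/
def relLift {m : ℕ} (y : Fin m → A) (h : Fin k → A) :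
    Coprod (FreeGroup (Fin m)) (CoprodI fun j => 𝒜 j) →* A :=
  Coprod.lift (FreeGroup.lift y)
    (CoprodI.lift fun j => (MulAut.conj (h j)).toMonoidHom.comp (𝒜 j).subtype)

variable (𝒜) in
/-- `B` is the internal free product of a free group with basis `y` and the conjugates of the `A_j`
by `h j`. -/
def IsRelBasis {m : ℕ} (y : Fin m → A) (h : Fin k → A) (B : Subgroup A) : Prop :=
  Injective (relLift 𝒜 y h) ∧ (relLift 𝒜 y h).range = B

theorem range_conj_comp_subtype (g : A) (B : Subgroup A) :
    ((MulAut.conj g).toMonoidHom.comp B.subtype).range = MulAut.conj g • B := by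
  rw [MonoidHom.range_comp, Subgroup.range_subtype]; rfl

theorem range_lift_conj (h : Fin k → A) :
    (CoprodI.lift fun j => (MulAut.conj (h j)).toMonoidHom.comp (𝒜 j).subtype).range =
      ⨆ j, MulAut.conj (h j) • 𝒜 j := by
  rw [CoprodI.range_eq_iSup]
  simp only [range_conj_comp_subtype]

theorem range_relLift {m : ℕ} (y : Fin m → A) (h : Fin k → A) :
    (relLift 𝒜 y h).range = standardFactor y (fun j => MulAut.conj (h j) • 𝒜 j) m := by
  rw [relLift, Coprod.range_lift, range_lift_conj, FreeGroup.range_lift_eq_closure]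
  congr 2
  ext a
  simp [eq_comm]

theorem IsRelBasis.conj_le {m : ℕ} {y : Fin m → A} {h : Fin k → A} {B : Subgroup A}
    (hy : IsRelBasis 𝒜 y h B) (j : Fin k) : MulAut.conj (h j) • 𝒜 j ≤ B := by
  rw [← hy.2, range_relLift]
  exact le_sup_of_le_right (le_iSup (fun j => MulAut.conj (h j) • 𝒜 j) j)

theorem isRelBasis_one_iff {n : ℕ} {x : Fin n → A} :
    IsRelBasis 𝒜 x 1 ⊤ ↔ IsFreeProductDecomposition x 𝒜 := by
  have : relLift 𝒜 x 1 = Coprod.lift (FreeGroup.lift x)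
      (CoprodI.lift fun j => (𝒜 j).subtype) := by
    rw [relLift]
    congr 2
    funext j
    ext a
    simp
  rw [IsRelBasis, MonoidHom.range_eq_top, this]
  rfl

variable [Group.FG A] {n : ℕ} {x : Fin n → A}

/-- In `A ⧸ B` the base coset has stabiliser `B`, and `g • 𝒜 j ≤ B` says that `𝒜 j` fixes the coset
of `g⁻¹`. So `exists_stabilizer_splitting` splits `B`. -/
theorem IsFreeFactor.exists_isRelBasis (hA : IsFreeProductDecomposition x 𝒜) {B : Subgroup A}
    (hB : IsFreeFactor B) (h𝒜 : ∀ j, cls (𝒜 j) ≤ cls B) :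
    ∃ (m : ℕ) (y : Fin m → A) (h : Fin k → A), IsRelBasis 𝒜 y h B := by
  choose g hg using fun j => cls_le_iff.1 (h𝒜 j)
  have hfix : ∀ j (a : 𝒜 j), (𝒜 j).subtype a • (((g j)⁻¹ : A) : A ⧸ B) = ((g j)⁻¹ : A) := by
    intro j a
    have := hg j (Subgroup.smul_mem_pointwise_smul _ (MulAut.conj (g j)) _ a.2)
    rw [MulAction.Quotient.smul_coe, eq_comm, QuotientGroup.eq]
    simpa [mul_assoc] using this
  obtain ⟨K, p, -, -, hinj, hran⟩ := exists_stabilizer_splitting hA hfix ((1 : A) : A ⧸ B)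
  rw [MulAction.stabilizer_quotient] at hran
  obtain ⟨m, z, hz, rfl⟩ := exists_basis_of_complement hA hB hinj hran fun j =>
    ⟨(p j)⁻¹, by
      rw [range_lift_conj fun j => (p j)⁻¹]
      exact le_iSup (fun j => MulAut.conj (p j)⁻¹ • 𝒜 j) j⟩
  have key : relLift 𝒜 z (fun j => (p j)⁻¹) = (Coprod.lift (FreeGroup.lift z).range.subtype
      (CoprodI.lift fun j => (MulAut.conj (p j)⁻¹).toMonoidHom.comp (𝒜 j).subtype)).comp
      (MulEquiv.coprodCongr (MonoidHom.ofInjective hz) (MulEquiv.refl _)).toMonoidHom := by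
    refine Coprod.hom_ext ?_ ?_
    · ext a; rfl
    · ext a; rfl
  refine ⟨m, z, fun j => (p j)⁻¹, ?_, ?_⟩
  · rw [key, MonoidHom.coe_comp]
    exact hinj.comp (MulEquiv.injective _)
  · rw [key, range_comp_of_surjective _ (MulEquiv.surjective _), hran]

/-- Write `A = B ∗ D` and let it act on `A ⧸ C`. As `B ≤ C`, the factor `B` fixes the base coset
itself, so the conjugator is `1` and `C = K ∗ B` with `B` unchanged; a basis of `K` supplies the new
letters. -/
theorem IsRelBasis.exists_append (hA : IsFreeProductDecomposition x 𝒜) {B C : Subgroup A}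
    (hB : IsFreeFactor B) (hC : IsFreeFactor C) (hBC : B ≤ C) {i : ℕ} {y : Fin i → A}
    {h : Fin k → A} (hy : IsRelBasis 𝒜 y h B) :
    ∃ (m : ℕ) (z : Fin m → A), IsRelBasis 𝒜 (Fin.append y z) h C := by
  obtain ⟨D, hD⟩ := hB
  have hfix : ∀ (_ : Unit) (b : B), B.subtype b • ((1 : A) : A ⧸ C) = (1 : A) := by
    intro _ b
    rw [MulAction.Quotient.smul_coe, eq_comm, QuotientGroup.eq]
    simpa using hBC b.2
  obtain ⟨K, p, -, hp, hinj, hran⟩ := exists_stabilizer_splitting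
    (bijective_coprod_lift_unit_iff.2 hD) hfix ((1 : A) : A ⧸ C)
  rw [MulAction.stabilizer_quotient] at hran
  have hp1 : (fun j : Unit => (MulAut.conj (p j)⁻¹).toMonoidHom.comp B.subtype) =
      fun _ => B.subtype := by
    funext j
    rw [hp j rfl]
    ext b
    simp
  rw [hp1] at hinj hran
  obtain ⟨m, z, hz, rfl⟩ := exists_basis_of_complement hA hC hinj hran fun j =>
    ⟨h j, by rw [range_coprodI_lift_unit, Subgroup.range_subtype]; exact hy.conj_le j⟩
  refine ⟨m, z, ?_, ?_⟩
  · rw [relLift, injective_coprod_lift_append_iff]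
    refine (injective_coprod_lift_range_iff hy.1 hz).1 ?_
    have h2 := injective_coprod_lift_unit_iff.1 hinj
    obtain ⟨-, rfl⟩ := hy
    exact h2
  · rw [← hran, relLift, range_coprod_lift_append, Coprod.range_lift,
      Coprod.range_lift (FreeGroup.lift z).range.subtype, range_coprodI_lift_unit,
      Subgroup.range_subtype, Subgroup.range_subtype, ← hy.2, sup_comm]
    rfl

end RelBasis

/-! ### Relative bases adapted to chains -/

section Chains

variable {A : Type*} [Group A] {k : ℕ} {𝒜 : Fin k → Subgroup A}

theorem standardFactor_mono {n : ℕ} (x : Fin n → A) (ℬ : Fin k → Subgroup A) :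
    Monotone (standardFactor x ℬ) := fun _ _ hij =>
  sup_le_sup_right (Subgroup.closure_mono (by
    rintro _ ⟨l, hl, rfl⟩
    exact ⟨l, hl.trans_le hij, rfl⟩)) _

theorem standardFactor_append {i m : ℕ} (y : Fin i → A) (z : Fin m → A)
    (ℬ : Fin k → Subgroup A) {l : ℕ} (hl : l ≤ i) :
    standardFactor (Fin.append y z) ℬ l = standardFactor y ℬ l := by
  unfold standardFactor
  congr 2
  ext a
  constructor
  · rintro ⟨j, hj, rfl⟩
    revert hj
    refine Fin.addCases (fun a ha => ⟨a, ha, by simp⟩) (fun a ha => ?_) j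
    simp only [Fin.val_natAdd] at ha
    omega
  · rintro ⟨j, hj, rfl⟩
    exact ⟨Fin.castAdd m j, hj, by simp⟩

theorem IsRelBasis.isFreeFactor_standardFactor {n : ℕ} {y : Fin n → A} {h : Fin k → A}
    (hy : IsRelBasis 𝒜 y h ⊤) {i : ℕ} (hi : i ≤ n) :
    IsFreeFactor (standardFactor y (fun j => MulAut.conj (h j) • 𝒜 j) i) := by
  obtain ⟨m, rfl⟩ := Nat.exists_eq_add_of_le hi
  have happ : Fin.append (fun a => y (Fin.castAdd m a)) (fun a => y (Fin.natAdd i a)) = y := by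
    funext a
    refine Fin.addCases (fun a => ?_) (fun a => ?_) a <;> simp
  rw [← happ] at hy ⊢
  rw [standardFactor_append _ _ _ le_rfl, ← range_relLift]
  obtain ⟨h1, h2⟩ := hy
  rw [relLift, injective_coprod_lift_append_iff] at h1
  rw [relLift, range_coprod_lift_append, MonoidHom.range_eq_top] at h2
  exact ⟨_, IsFreeProduct.of_lift ⟨h1, h2⟩⟩

theorem isFreeFactor_top : IsFreeFactor (⊤ : Subgroup A) := by
  refine ⟨⊥, fun a b hab => ?_, fun a => ⟨Coprod.inl ⟨a, trivial⟩, by simp⟩⟩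
  have key : (Coprod.inl.comp Subgroup.topEquiv.symm.toMonoidHom).comp
      (Coprod.lift (⊤ : Subgroup A).subtype (⊥ : Subgroup A).subtype) = MonoidHom.id _ := by
    refine Coprod.hom_ext ?_ ?_
    · ext a; rfl
    · ext a
      rw [Subsingleton.elim a 1, map_one, map_one]
  simpa [hab] using (DFunLike.congr_fun key a).symm.trans
    ((congrArg (Coprod.inl.comp Subgroup.topEquiv.symm.toMonoidHom) hab).trans
      (DFunLike.congr_fun key b))

variable [Group.FG A] {n : ℕ} {x : Fin n → A}

/-- Every finite chain of classes of free factors relative to `𝒜` is realised by the standard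
factors of a single relative basis. -/
theorem exists_isRelBasis_of_isChain (hA : IsFreeProductDecomposition x 𝒜)
    (s : Finset (SubgroupClass A)) (hs : IsChain (· ≤ ·) (s : Set (SubgroupClass A)))
    (hfac : ∀ b ∈ s, ∃ B : Subgroup A, cls B = b ∧ IsFreeFactor B ∧ ∀ j, cls (𝒜 j) ≤ cls B)
    {C : Subgroup A} (hC : IsFreeFactor C) (h𝒜 : ∀ j, cls (𝒜 j) ≤ cls C)
    (hsC : ∀ b ∈ s, b ≤ cls C) :
    ∃ (m : ℕ) (y : Fin m → A) (h : Fin k → A), IsRelBasis 𝒜 y h C ∧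
      ∀ b ∈ s, ∃ i ≤ m, cls (standardFactor y (fun j => MulAut.conj (h j) • 𝒜 j) i) = b := by
  classical
  induction s using Finset.strongInduction generalizing C with
  | H s ih =>
    rcases s.eq_empty_or_nonempty with rfl | hne
    · obtain ⟨m, y, h, hy⟩ := hC.exists_isRelBasis hA h𝒜
      exact ⟨m, y, h, hy, by simp⟩
    -- The largest class is represented by a conjugate inside `C`. A basis of that conjugate adapted
    -- to the smaller classes is then extended to `C`.
    · obtain ⟨b, hb, hmax⟩ := s.exists_maximal hne
      have hle : ∀ c ∈ s, c ≤ b := fun c hc =>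
        (hs.total hc hb).elim id fun hbc => hmax hc hbc
      obtain ⟨B₀, rfl, hB₀, hB₀𝒜⟩ := hfac b hb
      obtain ⟨g, hg⟩ := cls_le_iff.1 (hsC _ hb)
      have hcls : cls (MulAut.conj g • B₀) = cls B₀ := (cls_eq_iff.2 ⟨g, rfl⟩).symm
      have hsub : s.erase (cls B₀) ⊆ s := Finset.erase_subset _ _
      obtain ⟨i, y, h, hy, hyi⟩ := ih _ (Finset.erase_ssubset hb)
        (hs.mono (Finset.coe_subset.2 hsub)) (fun c hc => hfac c (hsub hc))
        (hB₀.smul (MulAut.conj g)) (by rwa [hcls]) (fun c hc => by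
          rw [hcls]; exact hle c (hsub hc))
      obtain ⟨m, z, hz⟩ := hy.exists_append hA (hB₀.smul (MulAut.conj g)) hC hg
      refine ⟨i + m, _, h, hz, fun c hc => ?_⟩
      by_cases hcb : c = cls B₀
      · refine ⟨i, Nat.le_add_right _ _, ?_⟩
        rw [standardFactor_append _ _ _ le_rfl, ← range_relLift, hy.2, hcb, hcls]
      · obtain ⟨l, hl, hlc⟩ := hyi c (Finset.mem_erase.2 ⟨hcb, hc⟩)
        exact ⟨l, hl.trans (Nat.le_add_right _ _), by rw [standardFactor_append _ _ _ hl, hlc]⟩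

end Chains

/-! ### Automorphisms between relative bases -/

section Automorphisms

variable {A : Type*} [Group A] {k : ℕ} {𝒜 : Fin k → Subgroup A}

theorem conj_one_smul_family :
    (fun j => MulAut.conj ((1 : Fin k → A) j) • 𝒜 j) = 𝒜 := by
  funext j
  rw [Pi.one_apply, map_one, one_smul]

theorem toOut_conj_mul (g : A) (φ : MulAut A) : toOut (MulAut.conj g * φ) = toOut φ := by
  have : MulAut.conj g * φ = φ * MulAut.conj (φ⁻¹ g) := by
    rw [← mul_conj_mul_inv]; group
  rw [this]
  exact (QuotientGroup.mk_mul_of_mem φ ⟨_, rfl⟩)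

/-- One representative may conjugate different members by different elements, because the inner
correction is made for each member separately. -/
theorem toOut_mem_relOut_iff {𝒢 : Set (Subgroup A)} {φ : MulAut A} :
    toOut φ ∈ relOut ∅ 𝒢 ↔ ∀ H ∈ 𝒢, ∃ g : A, ∀ a ∈ H, φ a = g * a * g⁻¹ := by
  constructor
  · intro hφ H hH
    obtain ⟨ψ, hψ, hψH⟩ := hφ.2 H hH
    obtain ⟨g, hg⟩ := QuotientGroup.eq.1 hψ
    have hφψ : φ = ψ * MulAut.conj g := by rw [hg, mul_inv_cancel_left]
    refine ⟨ψ g, fun a ha => ?_⟩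
    rw [hφψ, MulAut.mul_apply, MulAut.conj_apply, map_mul, map_mul, map_inv, hψH a ha]
  · refine fun hφ => ⟨by simp, fun H hH => ?_⟩
    obtain ⟨g, hg⟩ := hφ H hH
    refine ⟨MulAut.conj g⁻¹ * φ, toOut_conj_mul _ _, fun a ha => ?_⟩
    rw [MulAut.mul_apply, hg a ha, MulAut.conj_apply]
    group

theorem out_smul_cls_eq_iff {Φ : Out A} {B C : Subgroup A} :
    Φ • cls B = cls C ↔ ∃ φ : MulAut A, toOut φ = Φ ∧ φ • B = C := by
  constructor
  · intro h
    obtain ⟨φ, rfl⟩ := QuotientGroup.mk_surjective Φ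
    obtain ⟨g, hg⟩ := cls_eq_iff.1 h
    exact ⟨MulAut.conj g * φ, toOut_conj_mul g φ, by rw [mul_smul, hg]⟩
  · rintro ⟨φ, rfl, rfl⟩
    rfl

theorem mem_stab_iff {O : Subgroup (Out A)} {Φ : O} {B : Subgroup A} :
    Φ ∈ stab O B ↔ (Φ : Out A) • cls B = cls B :=
  out_smul_cls_eq_iff.symm

theorem smul_standardFactor {n : ℕ} (φ : MulAut A) (x : Fin n → A) (ℬ : Fin k → Subgroup A)
    (i : ℕ) : φ • standardFactor x ℬ i = standardFactor (φ ∘ x) (fun j => φ • ℬ j) i := by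
  unfold standardFactor
  rw [Subgroup.smul_sup, Subgroup.smul_closure]
  congr 1
  · congr 1
    ext a
    constructor
    · rintro ⟨_, ⟨j, hj, rfl⟩, rfl⟩
      exact ⟨j, hj, rfl⟩
    · rintro ⟨j, hj, rfl⟩
      exact ⟨_, ⟨j, hj, rfl⟩, rfl⟩
  · exact Subgroup.map_iSup _ _

/-- The automorphism sends `x` to `y` and restricts to conjugation by `h j` on `𝒜 j`, which is what
membership in `O` requires. -/
theorem exists_mulAut_of_isRelBasis {n : ℕ} {x y : Fin n → A} {h : Fin k → A}
    (hx : IsRelBasis 𝒜 x 1 ⊤) (hy : IsRelBasis 𝒜 y h ⊤) :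
    ∃ φ : MulAut A, toOut φ ∈ relOut ∅ (Set.range 𝒜) ∧
      ∀ i, φ • standardFactor x 𝒜 i = standardFactor y (fun j => MulAut.conj (h j) • 𝒜 j) i := by
  let ex := MulEquiv.ofBijective _ ⟨hx.1, MonoidHom.range_eq_top.1 hx.2⟩
  let ey := MulEquiv.ofBijective _ ⟨hy.1, MonoidHom.range_eq_top.1 hy.2⟩
  let φ : MulAut A := ex.symm.trans ey
  have hφ : ∀ w, φ (relLift 𝒜 x 1 w) = relLift 𝒜 y h w := fun w =>
    congrArg ey (ex.symm_apply_apply w)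
  have hφx : ∀ i, φ (x i) = y i := fun i => by
    simpa [relLift] using hφ (Coprod.inl (FreeGroup.of i))
  have hφ𝒜 : ∀ j, ∀ a ∈ 𝒜 j, φ a = h j * a * (h j)⁻¹ := fun j a ha => by
    simpa [relLift] using hφ (Coprod.inr (CoprodI.of (i := j) ⟨a, ha⟩))
  refine ⟨φ, toOut_mem_relOut_iff.2 ?_, fun i => ?_⟩
  · rintro _ ⟨j, rfl⟩
    exact ⟨h j, hφ𝒜 j⟩
  · rw [smul_standardFactor]
    congr 1
    · exact funext hφx
    · funext j
      ext a
      constructor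
      · rintro ⟨b, hb, rfl⟩
        exact ⟨b, hb, (hφ𝒜 j b hb).symm⟩
      · rintro ⟨b, hb, rfl⟩
        exact ⟨b, hb, hφ𝒜 j b hb⟩

theorem IsRelBasis.comp_perm {n : ℕ} {y : Fin n → A} {h : Fin k → A} {B : Subgroup A}
    (hy : IsRelBasis 𝒜 y h B) (σ : Equiv.Perm (Fin n)) : IsRelBasis 𝒜 (y ∘ σ) h B := by
  have key : relLift 𝒜 (y ∘ σ) h = (relLift 𝒜 y h).comp
      (MulEquiv.coprodCongr (FreeGroup.freeGroupCongr σ) (MulEquiv.refl _)).toMonoidHom := by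
    refine Coprod.hom_ext (FreeGroup.ext_hom _ _ fun i => ?_) ?_
    · change _ = relLift 𝒜 y h (Coprod.inl (FreeGroup.freeGroupCongr σ (FreeGroup.of i)))
      simp [relLift]
    · ext a; rfl
  refine ⟨?_, ?_⟩
  · rw [key, MonoidHom.coe_comp]
    exact hy.1.comp (MulEquiv.injective _)
  · rw [key, range_comp_of_surjective _ (MulEquiv.surjective _), hy.2]

end Automorphisms

/-! ### The corank of a standard factor -/

section Corank

variable {A : Type*} [Group A] {k : ℕ} {𝒜 : Fin k → Subgroup A}

variable (𝒜) in
/-- The number of homomorphisms to the group of order two that are trivial on `B` and on all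
members of `𝒜`. -/
noncomputable def homCount (B : Subgroup A) : ℕ :=
  Nat.card {f : A →* Multiplicative (ZMod 2) // (∀ j, ∀ a ∈ 𝒜 j, f a = 1) ∧ ∀ b ∈ B, f b = 1}

theorem map_apply_eq_of_mem_relOut {M : Type*} [CommGroup M] {φ : MulAut A}
    (hφ : toOut φ ∈ relOut ∅ (Set.range 𝒜)) (f : A →* M) {j : Fin k} {a : A} (ha : a ∈ 𝒜 j) :
    f (φ a) = f a := by
  obtain ⟨g, hg⟩ := toOut_mem_relOut_iff.1 hφ _ ⟨j, rfl⟩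
  rw [hg a ha, map_mul, map_mul, map_inv, mul_inv_cancel_comm]

/-- Precomposition with `φ` preserves triviality on `𝒜 j`: there `φ` is a conjugation, invisible in
a commutative target. -/
theorem homCount_smul {φ : MulAut A} (hφ : toOut φ ∈ relOut ∅ (Set.range 𝒜)) (B : Subgroup A) :
    homCount 𝒜 (φ • B) = homCount 𝒜 B := by
  refine Nat.card_congr ⟨fun f => ⟨f.1.comp φ.toMonoidHom, fun j a ha => ?_, fun b hb => ?_⟩,
    fun f => ⟨f.1.comp φ⁻¹.toMonoidHom, fun j a ha => ?_, ?_⟩, fun f => ?_, fun f => ?_⟩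
  · exact (map_apply_eq_of_mem_relOut hφ f.1 ha).trans (f.2.1 j a ha)
  · exact f.2.2 _ ⟨b, hb, rfl⟩
  · exact (map_apply_eq_of_mem_relOut (φ := φ⁻¹) (inv_mem hφ) f.1 ha).trans (f.2.1 j a ha)
  · rintro _ ⟨b, hb, rfl⟩
    exact (congrArg f.1 (MulAut.inv_apply_self A φ b)).trans (f.2.2 b hb)
  · exact Subtype.ext (MonoidHom.ext fun a => congrArg f.1 (MulAut.apply_inv_self A φ a))
  · exact Subtype.ext (MonoidHom.ext fun a => congrArg f.1 (MulAut.inv_apply_self A φ a))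

theorem forall_mem_standardFactor_iff {M : Type*} [CommGroup M] {n : ℕ} {y : Fin n → A}
    {h : Fin k → A} {f : A →* M} (hf : ∀ j, ∀ a ∈ 𝒜 j, f a = 1) {i : ℕ} :
    (∀ b ∈ standardFactor y (fun j => MulAut.conj (h j) • 𝒜 j) i, f b = 1) ↔
      ∀ l : Fin n, (l : ℕ) < i → f (y l) = 1 := by
  constructor
  · exact fun H l hl => H _ ((le_sup_left : _ ≤ standardFactor y _ i)
      (Subgroup.subset_closure ⟨l, hl, rfl⟩))
  · intro H
    change standardFactor y _ i ≤ f.ker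
    refine sup_le ((Subgroup.closure_le _).2 ?_) (iSup_le fun j => ?_)
    · rintro _ ⟨l, hl, rfl⟩
      exact H l hl
    · rintro _ ⟨a, ha, rfl⟩
      change f (h j * a * (h j)⁻¹) = 1
      rw [map_mul, map_mul, map_inv, mul_inv_cancel_comm, hf j a ha]

theorem IsRelBasis.exists_hom {M : Type*} [CommGroup M] {n : ℕ} {y : Fin n → A} {h : Fin k → A}
    (hy : IsRelBasis 𝒜 y h ⊤) (v : Fin n → M) :
    ∃ f : A →* M, (∀ j, ∀ a ∈ 𝒜 j, f a = 1) ∧ f ∘ y = v := by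
  let e := MulEquiv.ofBijective _ ⟨hy.1, MonoidHom.range_eq_top.1 hy.2⟩
  let f : A →* M := (Coprod.lift (FreeGroup.lift v) 1).comp e.symm.toMonoidHom
  have hf : ∀ w, f (relLift 𝒜 y h w) = Coprod.lift (FreeGroup.lift v) 1 w := fun w =>
    congrArg (Coprod.lift (FreeGroup.lift v) 1) (e.symm_apply_apply w)
  refine ⟨f, fun j a ha => ?_, funext fun l => ?_⟩
  · have := hf (Coprod.inr (CoprodI.of (i := j) ⟨a, ha⟩))
    simpa [relLift] using this
  · have := hf (Coprod.inl (FreeGroup.of l))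
    simpa [relLift] using this

theorem IsRelBasis.hom_ext {M : Type*} [CommGroup M] {n : ℕ} {y : Fin n → A} {h : Fin k → A}
    (hy : IsRelBasis 𝒜 y h ⊤) {f f' : A →* M} (hf : ∀ j, ∀ a ∈ 𝒜 j, f a = 1)
    (hf' : ∀ j, ∀ a ∈ 𝒜 j, f' a = 1) (hff' : f ∘ y = f' ∘ y) : f = f' := by
  have key : f.comp (relLift 𝒜 y h) = f'.comp (relLift 𝒜 y h) := by
    refine Coprod.hom_ext (FreeGroup.ext_hom _ _ fun l => ?_)
      (CoprodI.ext_hom _ _ fun j => MonoidHom.ext fun a => ?_)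
    · simpa [relLift] using congrFun hff' l
    · simp [relLift, hf j a a.2, hf' j a a.2]
  ext a
  obtain ⟨w, rfl⟩ := MonoidHom.range_eq_top.1 hy.2 a
  exact DFunLike.congr_fun key w

/-- Such a homomorphism is determined by its values on the basis, which are trivial on the first `i`
elements and arbitrary on the other `n - i`. -/
theorem IsRelBasis.homCount_standardFactor {n : ℕ} {y : Fin n → A} {h : Fin k → A}
    (hy : IsRelBasis 𝒜 y h ⊤) {i : ℕ} (hi : i ≤ n) :
    homCount 𝒜 (standardFactor y (fun j => MulAut.conj (h j) • 𝒜 j) i) = 2 ^ (n - i) := by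
  let v₀ : {l : Fin n // (l : ℕ) < i} → Multiplicative (ZMod 2) := 1
  let F : {f : A →* Multiplicative (ZMod 2) // (∀ j, ∀ a ∈ 𝒜 j, f a = 1) ∧
      ∀ b ∈ standardFactor y (fun j => MulAut.conj (h j) • 𝒜 j) i, f b = 1} →
      {v : Fin n → Multiplicative (ZMod 2) // v ∘ (↑) = v₀} := fun f =>
    ⟨f.1 ∘ y, funext fun l => (forall_mem_standardFactor_iff f.2.1).1 f.2.2 l.1 l.2⟩
  have hF : Bijective F := by
    constructor
    · intro f f' hff'
      exact Subtype.ext (hy.hom_ext f.2.1 f'.2.1 (congrArg Subtype.val hff'))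
    · rintro ⟨v, hv⟩
      obtain ⟨f, hf, rfl⟩ := hy.exists_hom v
      exact ⟨⟨f, hf, (forall_mem_standardFactor_iff hf).2 fun l hl => congrFun hv ⟨l, hl⟩⟩, rfl⟩
  have hcard : Fintype.card {l : Fin n // ¬ (l : ℕ) < i} = n - i := by
    rw [Fintype.card_subtype_compl, Fintype.card_fin, Fintype.card_subtype, Fin.card_filter_val_lt,
      min_eq_right hi]
  rw [homCount, Nat.card_congr ((Equiv.ofBijective F hF).trans (Equiv.subtypePreimage _ v₀)),
    Nat.card_fun, Nat.card_eq_fintype_card, Nat.card_eq_fintype_card, hcard]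
  simp

/-- At index `0` the standard factor imposes nothing beyond triviality on `𝒜`, so both bases count
the same homomorphisms. -/
theorem IsRelBasis.length_eq {n m : ℕ} {x : Fin n → A} {y : Fin m → A} {h h' : Fin k → A}
    (hx : IsRelBasis 𝒜 x h ⊤) (hy : IsRelBasis 𝒜 y h' ⊤) : n = m := by
  have h1 := hx.homCount_standardFactor (Nat.zero_le n)
  have h2 := hy.homCount_standardFactor (Nat.zero_le m)
  have h3 : homCount 𝒜 (standardFactor x (fun j => MulAut.conj (h j) • 𝒜 j) 0) =
      homCount 𝒜 (standardFactor y (fun j => MulAut.conj (h' j) • 𝒜 j) 0) := by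
    refine Nat.card_congr (Equiv.subtypeEquivRight fun f => and_congr_right fun hf => ?_)
    rw [forall_mem_standardFactor_iff hf, forall_mem_standardFactor_iff hf]
    simp
  rw [h1, h2] at h3
  simpa using Nat.pow_right_injective le_rfl h3

variable {n : ℕ} {x : Fin n → A}

theorem standardFactor_index_eq (hx : IsRelBasis 𝒜 x 1 ⊤) {Φ : Out A}
    (hΦ : Φ ∈ relOut ∅ (Set.range 𝒜)) {i j : ℕ} (hi : i ≤ n) (hj : j ≤ n)
    (h : Φ • cls (standardFactor x 𝒜 i) = cls (standardFactor x 𝒜 j)) : i = j := by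
  obtain ⟨φ, rfl, hφ⟩ := out_smul_cls_eq_iff.1 h
  have h1 := hx.homCount_standardFactor hi
  have h2 := hx.homCount_standardFactor hj
  rw [conj_one_smul_family] at h1 h2
  rw [← hφ, homCount_smul hΦ, h1] at h2
  have := Nat.pow_right_injective le_rfl h2
  omega

theorem standardFactor_strictMonoOn (hx : IsRelBasis 𝒜 x 1 ⊤) {i j : ℕ} (hij : i < j)
    (hj : j ≤ n) : standardFactor x 𝒜 i < standardFactor x 𝒜 j :=
  lt_of_le_of_ne (standardFactor_mono x 𝒜 hij.le) fun h =>
    hij.ne (standardFactor_index_eq hx (one_mem _) (hij.le.trans hj) hj (by rw [h, one_smul]))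

theorem standardFactor_comp_swap (x : Fin n → A) (ℬ : Fin k → Subgroup A) {i : ℕ} {p q : Fin n}
    (hpq : (p : ℕ) < i ↔ (q : ℕ) < i) :
    standardFactor (x ∘ Equiv.swap p q) ℬ i = standardFactor x ℬ i := by
  have hlt : ∀ l : Fin n, ((Equiv.swap p q l : Fin n) : ℕ) < i ↔ (l : ℕ) < i := by
    intro l
    rw [Equiv.swap_apply_def]
    split_ifs with h1 h2
    · rw [h1, hpq]
    · rw [h2, hpq]
    · rfl
  unfold standardFactor
  congr 2
  ext a
  constructor
  · rintro ⟨l, hl, rfl⟩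
    exact ⟨_, (hlt l).2 hl, rfl⟩
  · rintro ⟨l, hl, rfl⟩
    exact ⟨Equiv.swap p q l, (hlt l).2 hl, by simp⟩

/-- Distinct standard factors have distinct stabilisers. -/
theorem eq_of_stab_standardFactor_eq (hx : IsRelBasis 𝒜 x 1 ⊤) {i j : ℕ}
    (hj1 : 1 ≤ j) (hjn : j < n)
    (h : stab (relOut ∅ (Set.range 𝒜)) (standardFactor x 𝒜 i) =
      stab (relOut ∅ (Set.range 𝒜)) (standardFactor x 𝒜 j)) : i = j := by
  by_contra hij
  -- Swapping the basis elements in positions `j - 1` and `j` (counted from `0`) preserves `S_i` for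
  -- every `i ≠ j`, as both or neither lie below `i`.
  let p : Fin n := ⟨j - 1, by omega⟩
  let q : Fin n := ⟨j, hjn⟩
  obtain ⟨φ, hφ, hφS⟩ := exists_mulAut_of_isRelBasis hx (hx.comp_perm (Equiv.swap p q))
  rw [conj_one_smul_family] at hφS
  have hmem : (⟨toOut φ, hφ⟩ : relOut ∅ (Set.range 𝒜)) ∈
      stab (relOut ∅ (Set.range 𝒜)) (standardFactor x 𝒜 i) := by
    refine ⟨φ, rfl, ?_⟩
    rw [hφS, standardFactor_comp_swap]
    simp only [p, q]
    omega
  rw [h, mem_stab_iff] at hmem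
  change cls (φ • standardFactor x 𝒜 j) = _ at hmem
  rw [hφS] at hmem
  obtain ⟨g, hg⟩ := cls_eq_iff.1 hmem
  -- This `f` kills `S_j`, hence all its conjugates, but not `x q`, which lies in the image of `S_j`
  -- under the swap.
  obtain ⟨f, hf, hfx⟩ := hx.exists_hom
    (Pi.mulSingle q (Multiplicative.ofAdd (1 : ZMod 2)))
  have hker : ∀ b ∈ standardFactor x 𝒜 j, f b = 1 := by
    have := (forall_mem_standardFactor_iff (y := x) (h := 1) (i := j) hf).2 fun l hl => by
      have hlq : l ≠ q := fun hlq => by simp [hlq, q] at hl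
      rw [← comp_apply (f := f), hfx, Pi.mulSingle_eq_of_ne hlq]
    rwa [conj_one_smul_family] at this
  have hq : x q ∈ standardFactor (x ∘ Equiv.swap p q) 𝒜 j :=
    (le_sup_left : _ ≤ standardFactor (x ∘ Equiv.swap p q) 𝒜 j)
      (Subgroup.subset_closure ⟨p, by simp only [p]; omega, by simp⟩)
  have h1 := hker (g * x q * g⁻¹) (hg ▸ ⟨x q, hq, rfl⟩)
  rw [map_mul, map_mul, map_inv, mul_inv_cancel_comm, ← comp_apply (f := f), hfx] at h1
  simp at h1

end Corank

/-! ### The isomorphism -/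

section Main

variable {A : Type*} [Group A] {n k : ℕ} {x : Fin n → A} {𝒜 : Fin k → Subgroup A}

theorem cls_le_standardFactor (x : Fin n → A) (i : ℕ) (j : Fin k) :
    cls (𝒜 j) ≤ cls (standardFactor x 𝒜 i) :=
  ⟨_, _, rfl, rfl, le_sup_of_le_right (le_iSup 𝒜 j)⟩

/-- The vertex of the free factor complex given by a standard factor. -/
def standardVertex (hx : IsRelBasis 𝒜 x 1 ⊤) (i : ℕ) (hi : 1 ≤ i ∧ i < n) :
    RelFreeFactor (Set.range 𝒜) :=
  ⟨cls (standardFactor x 𝒜 i), standardFactor x 𝒜 i, rfl,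
    by simpa only [conj_one_smul_family] using hx.isFreeFactor_standardFactor hi.2.le,
    ((standardFactor_strictMonoOn hx hi.2 le_rfl).trans_le le_top).ne,
    standardFactor x 𝒜 0,
    by simpa only [conj_one_smul_family] using hx.isFreeFactor_standardFactor (Nat.zero_le n),
    by rintro _ ⟨j, rfl⟩; exact cls_le_standardFactor x 0 j,
    standardFactor_strictMonoOn hx hi.1 hi.2.le⟩

theorem RelFreeFactor.exists_isFreeFactor (b : RelFreeFactor (Set.range 𝒜)) :
    ∃ B : Subgroup A, cls B = b.1 ∧ IsFreeFactor B ∧ ∀ j, cls (𝒜 j) ≤ cls B := by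
  obtain ⟨_, B, rfl, hB, -, B', -, hB', hlt⟩ := b
  exact ⟨B, rfl, hB, fun j => (hB' _ ⟨j, rfl⟩).trans ⟨B', B, rfl, rfl, hlt.le⟩⟩

variable (x) in
/-- The set of all `Φ ∈ O` that carry a proper standard factor to `b`. -/
def carrierSet (b : RelFreeFactor (Set.range 𝒜)) : Set (relOut ∅ (Set.range 𝒜)) :=
  {Φ | ∃ i : ℕ, (1 ≤ i ∧ i < n) ∧ (Φ : Out A) • cls (standardFactor x 𝒜 i) = b.1}

/-- If `Ψ` carries another standard factor to `b`, then `Φ⁻¹ * Ψ` relates the two standard factors,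
which forces equal indices. -/
theorem carrierSet_eq (hx : IsRelBasis 𝒜 x 1 ⊤) {b : RelFreeFactor (Set.range 𝒜)}
    {Φ : relOut ∅ (Set.range 𝒜)} {i : ℕ} (hi : 1 ≤ i ∧ i < n)
    (h : (Φ : Out A) • cls (standardFactor x 𝒜 i) = b.1) :
    carrierSet x b = Φ • (stab (relOut ∅ (Set.range 𝒜)) (standardFactor x 𝒜 i) :
      Set (relOut ∅ (Set.range 𝒜))) := by
  ext Ψ
  rw [Set.mem_smul_set_iff_inv_smul_mem, SetLike.mem_coe, mem_stab_iff, smul_eq_mul,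
    Subgroup.coe_mul, Subgroup.coe_inv, mul_smul, inv_smul_eq_iff, h]
  constructor
  · rintro ⟨i', hi', h'⟩
    have : i' = i := standardFactor_index_eq hx (Φ⁻¹ * Ψ).2 hi'.2.le hi.2.le (by
      rw [Subgroup.coe_mul, Subgroup.coe_inv, mul_smul, h', inv_smul_eq_iff, h])
    rwa [this] at h'
  · exact fun hΨ => ⟨i, hi, hΨ⟩

variable [Group.FG A]

/-- A relative basis of `A` adapted to the chain has length `n`, so an element of `O` carries the
given basis to it. The indices `0` and `n` are still allowed. -/
theorem exists_smul_standardFactor_of_isChain (hA : IsFreeProductDecomposition x 𝒜)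
    (s : Finset (SubgroupClass A)) (hs : IsChain (· ≤ ·) (s : Set (SubgroupClass A)))
    (hfac : ∀ b ∈ s, ∃ B : Subgroup A, cls B = b ∧ IsFreeFactor B ∧ ∀ j, cls (𝒜 j) ≤ cls B) :
    ∃ Φ : relOut ∅ (Set.range 𝒜), ∀ b ∈ s, ∃ i ≤ n,
      (Φ : Out A) • cls (standardFactor x 𝒜 i) = b := by
  have hx := isRelBasis_one_iff.2 hA
  have htop : ∀ B : Subgroup A, cls B ≤ cls ⊤ := fun B => ⟨B, ⊤, rfl, rfl, le_top⟩
  obtain ⟨m, y, h, hy, hys⟩ := exists_isRelBasis_of_isChain hA s hs hfac isFreeFactor_top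
    (fun j => htop _) (fun b hb => by obtain ⟨B, rfl, -⟩ := hfac b hb; exact htop B)
  obtain rfl := hx.length_eq hy
  obtain ⟨φ, hφ, hφS⟩ := exists_mulAut_of_isRelBasis hx hy
  refine ⟨⟨toOut φ, hφ⟩, fun b hb => ?_⟩
  obtain ⟨i, hi, rfl⟩ := hys b hb
  exact ⟨i, hi, congrArg cls (hφS i)⟩

/-- Every vertex of the free factor complex is a translate of a proper standard factor. -/
theorem RelFreeFactor.exists_smul_standardFactor (hA : IsFreeProductDecomposition x 𝒜)
    (b : RelFreeFactor (Set.range 𝒜)) :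
    ∃ (Φ : relOut ∅ (Set.range 𝒜)) (i : ℕ), (1 ≤ i ∧ i < n) ∧
      (Φ : Out A) • cls (standardFactor x 𝒜 i) = b.1 := by
  classical
  have hx := isRelBasis_one_iff.2 hA
  obtain ⟨_, B, rfl, hB, hBtop, B', hB'f, hB', hlt⟩ := b
  have hle : cls B' ≤ cls B := ⟨B', B, rfl, rfl, hlt.le⟩
  -- Including the smaller factor `B'` in the chain is what rules out index `0` for `B`.
  obtain ⟨Φ, hΦ⟩ := exists_smul_standardFactor_of_isChain hA {cls B', cls B}
    (by simpa using IsChain.pair hle)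
    (by
      intro b hb
      rw [Finset.mem_insert, Finset.mem_singleton] at hb
      rcases hb with rfl | rfl
      · exact ⟨B', rfl, hB'f, fun j => hB' _ ⟨j, rfl⟩⟩
      · exact ⟨B, rfl, hB, fun j => (hB' _ ⟨j, rfl⟩).trans hle⟩)
  obtain ⟨i', hi', h'⟩ := hΦ (cls B') (by simp)
  obtain ⟨i, hi, h⟩ := hΦ (cls B) (by simp)
  have htop : standardFactor x 𝒜 n = ⊤ := by
    rw [← hx.2, range_relLift, conj_one_smul_family]
  refine ⟨Φ, i, ⟨?_, ?_⟩, h⟩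
  -- Index `0` would conjugate `B` into `B' < B`, whereas a free factor is never conjugate into a
  -- proper subgroup of itself.
  · by_contra hi0
    obtain rfl : i = 0 := by omega
    have hBB' : cls B ≤ cls B' := by
      rw [← h, ← h']
      obtain ⟨φ, hφ⟩ := QuotientGroup.mk_surjective (Φ : Out A)
      rw [← hφ]
      exact ⟨_, _, rfl, rfl, Subgroup.pointwise_smul_le_pointwise_smul_iff.2
        (standardFactor_mono x 𝒜 (Nat.zero_le i'))⟩
    obtain ⟨g, hg⟩ := cls_le_iff.1 hBB'
    have := hB.conj_eq (hg.trans hlt.le)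
    exact (this ▸ hg).not_gt hlt
  · refine lt_of_le_of_ne hi fun hin => hBtop ?_
    rw [hin, htop] at h
    obtain ⟨φ, -, hφ⟩ := out_smul_cls_eq_iff.1 h
    rw [← hφ]
    exact eq_top_iff.2 fun a _ => ⟨φ⁻¹ a, trivial, MulAut.apply_inv_self A φ a⟩

end Main

end RelFF

theorem mainTheorem7 {A : Type*} [Group A] [Group.FG A] {n k : ℕ} (hn : 2 ≤ n)
    (x : Fin n → A) (𝒜 : Fin k → Subgroup A) (hA : RelFF.IsFreeProductDecomposition x 𝒜) :
    RelFF.EquivariantlyIsomorphic (RelFF.relOut ∅ (Set.range 𝒜))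
      (RelFF.freeFactorComplex (Set.range 𝒜))
      (RelFF.cosetComplex (RelFF.parabolics x 𝒜)) := by
  classical
  open RelFF in
  have hx := isRelBasis_one_iff.2 hA
  let E : RelFreeFactor (Set.range 𝒜) → cosets (parabolics x 𝒜) := fun b =>
    ⟨carrierSet x b, by
      obtain ⟨Φ, i, hi, h⟩ := b.exists_smul_standardFactor hA
      exact ⟨_, ⟨i, hi.1, hi.2, rfl⟩, Φ, carrierSet_eq hx hi h⟩⟩
  have hE : Function.Bijective E := by
    constructor
    · intro b b' hbb'
      have hset : carrierSet x b = carrierSet x b' := congrArg Subtype.val hbb'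
      obtain ⟨Φ, i, hi, h⟩ := b.exists_smul_standardFactor hA
      have hΦ' : Φ ∈ carrierSet x b' := hset ▸ ⟨i, hi, h⟩
      obtain ⟨i', hi', h'⟩ := hΦ'
      -- Both cosets are written with the same representative `Φ`, so their equality is one of
      -- stabilisers, which determine the index.
      rw [carrierSet_eq hx hi h, carrierSet_eq hx hi' h'] at hset
      obtain rfl := eq_of_stab_standardFactor_eq hx hi'.1 hi'.2
        (SetLike.coe_injective (smul_left_cancel Φ hset))
      exact Subtype.ext (h.symm.trans h')
    · rintro ⟨_, _, ⟨i, hi1, hin, rfl⟩, Φ, rfl⟩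
      exact ⟨Φ • standardVertex hx i ⟨hi1, hin⟩, Subtype.ext (carrierSet_eq hx ⟨hi1, hin⟩ rfl)⟩
  refine ⟨Equiv.ofBijective E hE, fun s => ?_, fun Φ b => Subtype.ext ?_⟩
  · have hface : s.map (Equiv.ofBijective E hE).toEmbedding ∈
        (cosetComplex (parabolics x 𝒜)).faces ↔
        s.Nonempty ∧ ∃ Φ, ∀ b ∈ s, Φ ∈ carrierSet x b := by
      change (s.map (Equiv.ofBijective E hE).toEmbedding).Nonempty ∧
        (⋂ U ∈ s.map (Equiv.ofBijective E hE).toEmbedding,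
          (U : Set (relOut ∅ (Set.range 𝒜)))).Nonempty ↔ _
      rw [Finset.map_nonempty]
      refine and_congr_right fun _ => exists_congr fun Φ => ?_
      rw [Set.mem_iInter₂]
      constructor
      · exact fun H b hb => H (E b) (Finset.mem_map_of_mem _ hb)
      · intro H U hU
        obtain ⟨b, hb, rfl⟩ := Finset.mem_map.1 hU
        exact H b hb
    rw [hface]
    refine and_congr_right fun _ => ⟨?_, fun hs => ?_⟩
    · rintro ⟨Φ, hΦ⟩ b hb c hc -
      obtain ⟨i, -, hi⟩ := hΦ b hb
      obtain ⟨j, -, hj⟩ := hΦ c hc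
      obtain ⟨φ, hφ⟩ := QuotientGroup.mk_surjective (Φ : Out A)
      have key : ∀ {b c : RelFreeFactor (Set.range 𝒜)} {i j : ℕ}, i ≤ j →
          (Φ : Out A) • cls (standardFactor x 𝒜 i) = b.1 →
          (Φ : Out A) • cls (standardFactor x 𝒜 j) = c.1 → b ≤ c := by
        intro b c i j hij hb hc
        rw [← hφ] at hb hc
        exact ⟨_, _, hb, hc, Subgroup.pointwise_smul_le_pointwise_smul_iff.2
          (standardFactor_mono x 𝒜 hij)⟩
      exact (le_total i j).imp (fun hij => key hij hi hj) (fun hji => key hji hj hi)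
    · obtain ⟨Φ, hΦ⟩ := exists_smul_standardFactor_of_isChain hA
        (s.image fun b : RelFreeFactor (Set.range 𝒜) => b.1)
        (by
          rw [Finset.coe_image]
          rintro _ ⟨b, hb, rfl⟩ _ ⟨c, hc, rfl⟩ -
          exact hs.total hb hc)
        (fun b hb => by
          obtain ⟨b, -, rfl⟩ := Finset.mem_image.1 hb
          exact RelFreeFactor.exists_isFreeFactor b)
      refine ⟨Φ, fun b hb => ?_⟩
      obtain ⟨i, hi, h⟩ := hΦ b.1
        (Finset.mem_image_of_mem (fun b : RelFreeFactor (Set.range 𝒜) => b.1) hb)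
      -- The chain lemma gives only `i ≤ n`; comparison with the proper index `j` of the vertex `b`
      -- shows `1 ≤ i < n`.
      obtain ⟨Ψ, j, hj, h'⟩ := b.exists_smul_standardFactor hA
      obtain rfl : j = i := standardFactor_index_eq hx (Φ⁻¹ * Ψ).2 hj.2.le hi (by
        rw [Subgroup.coe_mul, Subgroup.coe_inv, mul_smul, h', inv_smul_eq_iff, h])
      exact ⟨j, hj, h⟩
  · change carrierSet x (Φ • b) = Φ • carrierSet x b
    ext Ψ
    rw [Set.mem_smul_set_iff_inv_smul_mem]
    refine exists_congr fun i => and_congr_right fun _ => ?_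
    rw [smul_eq_mul, Subgroup.coe_mul, Subgroup.coe_inv, mul_smul, inv_smul_eq_iff]
    rfl
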